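/- **Proposition 1 (Hidden regularity).** Let $\Omega=(0,1)$, $T>0$, $Q_T=\Omega\times(0,T)$. Let $H^1_{(0)}(\Omega)=\{z\in H^1(\Omega):\ z(0)=0\}$ with the norm $\|z\|_{H^1_{(0)}(\Omega)}=\|\partial_x z\|_{L^2(\Omega)}$, and let $H^{-1}_{(0)}(\Omega)$ be its dual space with the dual norm. There is a constant $C>0$, depending only on $T$ (and on the fixed domain $\Omega$), such that the following holds for all $A\in L^\infty(Q_T)$ and all $(\varphi_0,\varphi_1)\in L^2(\Omega)\times H^{-1}_{(0)}(\Omega)$. Let $\varphi\in L^2(Q_T)$ be the solution in the sense of transposition of $$\partial_{tt}\varphi-\partial_{xx}\varphi+A\varphi=0\ \text{ in }Q_T,\qquad \varphi(0,\cdot)=0,\ \ \partial_x\varphi(1,\cdot)=0\ \text{ on }(0,T),\qquad (\varphi,\partial_t\varphi)(\cdot,0)=(\varphi_0,\varphi_1)\ \text{ in }\Omega,$$ that is, $$\int_{Q_T}\varphi\, g\,\mathrm dx\,\mathrm dt=\langle\varphi_1,w(\cdot,0)\rangle_{H^{-1}_{(0)}(\Omega),H^1_{(0)}(\Omega)}-\int_\Omega\varphi_0(x)\,\partial_t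 w(x,0)\,\mathrm dx\qquad\text{for all } g\in L^2(Q_T),$$ where $w\in C^0([0,T];H^1_{(0)}(\Omega))\cap C^1([0,T];L^2(\Omega))\cap H^2(0,T;H^{-1}_{(0)}(\Omega))$ is the weak solution of the backward problem $\partial_{tt}w-\partial_{xx}w+Aw=g$ in $Q_T$, $w(0,\cdot)=0$, $\partial_xw(1,\cdot)=0$ on $(0,T)$, $(w,\partial_tw)(\cdot,T)=(0,0)$ in $\Omega$, i.e. $w(\cdot,T)=0$, $\partial_tw(\cdot,T)=0$ and, for a.e. $t\in(0,T)$ and all $z\in H^1_{(0)}(\Omega)$, $$\langle\partial_{tt}w(\cdot,t),z\rangle_{H^{-1}_{(0)}(\Omega),H^1_{(0)}(\Omega)}+\int_\Omega\partial_xw\,\partial_xz\,\mathrm dx+\int_\Omega A\,w\,z\,\mathrm dx=\int_\Omega g\,z\,\mathrm dx .$$ Then the trace $\varphi(1,\cdot)$ exists and belongs to $L^2(0,T)$, in the sense that $\varphi$ coincides almost everywhere in $Q_T$ with an element $x\mapsto\Phi(x)$ of $C^0([0,1];L^2(0,T))$, and $\varphi(1,\cdot):=\Phi(1)$. Moreover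 $$\|\varphi(1,\cdot)\|_{L^2(0,T)}\le C\,e^{C\sqrt{\|A\|_{L^\infty(Q_T)}}}\left(\|\varphi_0\|_{L^2(\Omega)}^2+\|\varphi_1\|_{H^{-1}_{(0)}(\Omega)}^2\right)^{1/2}.$$ -/

import Mathlib

noncomputable section

namespace HiddenReg

open MeasureTheory Set
open scoped ContDiff

/-- Lebesgue measure on `Ω = (0,1)`. -/
abbrev muOmega : Measure ℝ := volume.restrict (Ioo (0 : ℝ) 1)

/-- The space-time cylinder `Q_T = (0,1) × (0,T)`; points are written `(x, t)`. -/
abbrev cyl (T : ℝ) : Set (ℝ × ℝ) := Ioo (0 : ℝ) 1 ×ˢ Ioo (0 : ℝ) T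

/-- `L²(Ω)`. -/
abbrev L2Omega : Type := Lp ℝ 2 muOmega

/-- `L²(0,T)`. -/
abbrev L2Time (T : ℝ) : Type := Lp ℝ 2 (volume.restrict (Ioo (0 : ℝ) T))

/-- `L²(Q_T)`. -/
abbrev L2Cyl (T : ℝ) : Type := Lp ℝ 2 (volume.restrict (cyl T))

/-- `L^∞(Q_T)`. -/
abbrev LinfCyl (T : ℝ) : Type := Lp ℝ ⊤ (volume.restrict (cyl T))

/-- `v` is the weak derivative of `u` on `Ω = (0,1)`. -/
def IsWeakDeriv (u v : L2Omega) : Prop :=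
  ∀ ψ : ℝ → ℝ, ContDiff ℝ ∞ ψ → HasCompactSupport ψ → tsupport ψ ⊆ Ioo (0 : ℝ) 1 →
    ∫ x in Ioo (0 : ℝ) 1, u x * deriv ψ x = -∫ x in Ioo (0 : ℝ) 1, v x * ψ x

/-- The boundary condition `u(0) = 0`, read on the continuous representative of `u` on `[0,1]`. -/
def VanishesAtZero (u : L2Omega) : Prop :=
  ∃ f : ℝ → ℝ, ContinuousOn f (Icc 0 1) ∧ f 0 = 0 ∧ u =ᵐ[muOmega] f

theorem integrable_mul_of_bound (u : L2Omega) {f : ℝ → ℝ} (hf : Continuous f)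
    (hc : HasCompactSupport f) : Integrable (fun x => u x * f x) muOmega := by
  have h1 : Integrable u muOmega := (Lp.memLp u).integrable (by norm_num)
  obtain ⟨C, hC⟩ := hf.bounded_above_of_compact_support hc
  exact h1.mul_bdd (c := C) hf.aestronglyMeasurable (Filter.Eventually.of_forall hC)

theorem isWeakDeriv_add {u v u' v' : L2Omega} (h : IsWeakDeriv u u') (k : IsWeakDeriv v v') :
    IsWeakDeriv (u + v) (u' + v') := by
  intro ψ h1 h2 h3
  have hd : Continuous (deriv ψ) := h1.continuous_deriv (by simp)
  have e1 : ∫ x in Ioo (0 : ℝ) 1, (u + v : L2Omega) x * deriv ψ x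
      = ∫ x in Ioo (0 : ℝ) 1, (u x * deriv ψ x + v x * deriv ψ x) := by
    refine integral_congr_ae ?_
    filter_upwards [Lp.coeFn_add u v] with x hx
    rw [hx, Pi.add_apply, add_mul]
  have e2 : ∫ x in Ioo (0 : ℝ) 1, (u' + v' : L2Omega) x * ψ x
      = ∫ x in Ioo (0 : ℝ) 1, (u' x * ψ x + v' x * ψ x) := by
    refine integral_congr_ae ?_
    filter_upwards [Lp.coeFn_add u' v'] with x hx
    rw [hx, Pi.add_apply, add_mul]
  rw [e1, e2, integral_add (integrable_mul_of_bound u hd h2.deriv)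
    (integrable_mul_of_bound v hd h2.deriv), integral_add
    (integrable_mul_of_bound u' h1.continuous h2) (integrable_mul_of_bound v' h1.continuous h2),
    h ψ h1 h2 h3, k ψ h1 h2 h3]
  ring

theorem isWeakDeriv_smul (c : ℝ) {u u' : L2Omega} (h : IsWeakDeriv u u') :
    IsWeakDeriv (c • u) (c • u') := by
  intro ψ h1 h2 h3
  have e1 : ∫ x in Ioo (0 : ℝ) 1, (c • u : L2Omega) x * deriv ψ x
      = ∫ x in Ioo (0 : ℝ) 1, c * (u x * deriv ψ x) := by
    refine integral_congr_ae ?_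
    filter_upwards [Lp.coeFn_smul c u] with x hx
    rw [hx, Pi.smul_apply, smul_eq_mul, mul_assoc]
  have e2 : ∫ x in Ioo (0 : ℝ) 1, (c • u' : L2Omega) x * ψ x
      = ∫ x in Ioo (0 : ℝ) 1, c * (u' x * ψ x) := by
    refine integral_congr_ae ?_
    filter_upwards [Lp.coeFn_smul c u'] with x hx
    rw [hx, Pi.smul_apply, smul_eq_mul, mul_assoc]
  rw [e1, e2, integral_const_mul, integral_const_mul, h ψ h1 h2 h3]
  ring

theorem isWeakDeriv_zero : IsWeakDeriv 0 0 := by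
  simpa using isWeakDeriv_smul 0 (u := 0) (u' := 0) (fun ψ _ _ _ => by
    have e : ∀ f : ℝ → ℝ, ∫ x in Ioo (0 : ℝ) 1, (0 : L2Omega) x * f x = 0 := fun f => by
      refine integral_eq_zero_of_ae ?_
      filter_upwards [Lp.coeFn_zero ℝ 2 muOmega] with x hx
      simp only [hx, Pi.zero_apply, zero_mul]
    rw [e, e, neg_zero])

theorem exists_primitive {h : ℝ → ℝ} (h1 : ContDiff ℝ ∞ h) (h2 : HasCompactSupport h)
    (h3 : tsupport h ⊆ Ioo (0 : ℝ) 1) (h4 : ∫ x, h x = 0) :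
    ∃ ψ : ℝ → ℝ, ContDiff ℝ ∞ ψ ∧ HasCompactSupport ψ ∧ tsupport ψ ⊆ Ioo (0 : ℝ) 1 ∧
      deriv ψ = h := by
  obtain ⟨a, b, ha, hb, hab⟩ : ∃ a b : ℝ, 0 < a ∧ b < 1 ∧ tsupport h ⊆ Icc a b := by
    rcases (tsupport h).eq_empty_or_nonempty with he | hne
    · exact ⟨1 / 2, 1 / 2, by norm_num, by norm_num, by simp [he]⟩
    · obtain ⟨a, ha, ha'⟩ := h2.isCompact.exists_isLeast hne
      obtain ⟨b, hb, hb'⟩ := h2.isCompact.exists_isGreatest hne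
      exact ⟨a, b, (h3 ha).1, (h3 hb).2, fun x hx => ⟨ha' hx, hb' hx⟩⟩
  have hz : ∀ x, x ∉ Icc a b → h x = 0 := fun x hx => image_eq_zero_of_notMem_tsupport
    (fun k => hx (hab k))
  have hd : ∀ x, HasDerivAt (fun x => ∫ s in (0 : ℝ)..x, h s) (h x) x := fun x =>
    intervalIntegral.integral_hasDerivAt_right (h1.continuous.intervalIntegrable _ _)
      (h1.continuous.stronglyMeasurableAtFilter _ _) h1.continuous.continuousAt
  have hde : deriv (fun x => ∫ s in (0 : ℝ)..x, h s) = h := funext fun x => (hd x).deriv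
  have hz0 : ∀ x, x ∉ Icc a b → ∫ s in (0 : ℝ)..x, h s = 0 := by
    intro x hx
    by_cases hxa : x < a
    · have : ∀ s ∈ uIcc 0 x, h s = 0 := by
        intro s hs
        refine hz s fun k => ?_
        have := hs.2
        have h5 : max 0 x < a := max_lt ha hxa
        linarith [k.1]
      rw [intervalIntegral.integral_congr (g := fun _ => 0) this]
      simp
    · have hbx : b < x := by
        by_contra hc
        exact hx ⟨not_lt.1 hxa, not_lt.1 hc⟩
      have hx0 : 0 ≤ x := by linarith [not_lt.1 hxa]
      rw [intervalIntegral.integral_of_le hx0, setIntegral_eq_integral_of_forall_compl_eq_zero, h4]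
      intro s hs
      refine hz s fun k => hs ⟨by linarith [k.1], by linarith [k.2]⟩
  have hts : tsupport (fun x => ∫ s in (0 : ℝ)..x, h s) ⊆ Icc a b :=
    closure_minimal (fun x hx => by
      by_contra hc
      exact hx (hz0 x hc)) isClosed_Icc
  refine ⟨fun x => ∫ s in (0 : ℝ)..x, h s, ?_, ?_, hts.trans fun x hx => ⟨by linarith [hx.1],
    by linarith [hx.2]⟩, hde⟩
  · rw [contDiff_infty_iff_deriv, hde]
    exact ⟨fun x => (hd x).differentiableAt, h1⟩
  · exact isCompact_Icc.of_isClosed_subset (isClosed_tsupport _) hts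

theorem eq_zero_of_isWeakDeriv_zero {u : L2Omega} (h : IsWeakDeriv u 0) (hv : VanishesAtZero u) :
    u = 0 := by
  have hu : Integrable u muOmega := (Lp.memLp u).integrable (by norm_num)
  let η : ContDiffBump (1 / 2 : ℝ) := ⟨1 / 8, 1 / 4, by norm_num, by norm_num⟩
  have n1 : ContDiff ℝ ∞ (η.normed volume) := η.contDiff_normed
  have n2 : HasCompactSupport (η.normed volume) := η.hasCompactSupport_normed
  have n3 : tsupport (η.normed volume) ⊆ Ioo (0 : ℝ) 1 := by
    rw [η.tsupport_normed_eq, Real.closedBall_eq_Icc]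
    intro x hx
    have h1 := hx.1
    have h2 := hx.2
    simp only [η] at h1 h2
    exact ⟨by linarith, by linarith⟩
  set c : ℝ := ∫ x in Ioo (0 : ℝ) 1, u x * η.normed volume x with hc
  have key : ∀ g : ℝ → ℝ, ContDiff ℝ ∞ g → HasCompactSupport g → tsupport g ⊆ Ioo (0 : ℝ) 1 →
      ∫ x in Ioo (0 : ℝ) 1, g x • (u x - c) = 0 := by
    intro g g1 g2 g3
    set m : ℝ := ∫ x, g x with hm
    have gi : Integrable g := g1.continuous.integrable_of_hasCompactSupport g2
    have ni : Integrable (η.normed volume) := n1.continuous.integrable_of_hasCompactSupport n2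
    have ts : tsupport (fun x => g x - m * η.normed volume x) ⊆ tsupport g ∪
        tsupport (η.normed volume) := by
      refine closure_minimal (fun x hx => ?_)
        ((isClosed_tsupport _).union (isClosed_tsupport _))
      by_contra hcon
      rw [mem_union, not_or] at hcon
      refine hx ?_
      simp only [image_eq_zero_of_notMem_tsupport hcon.1,
        image_eq_zero_of_notMem_tsupport hcon.2, mul_zero, sub_zero]
    obtain ⟨ψ, p1, p2, p3, p4⟩ := exists_primitive (h := fun x => g x - m * η.normed volume x)
      (g1.sub (contDiff_const.mul n1))
      ((g2.isCompact.union n2.isCompact).of_isClosed_subset (isClosed_tsupport _) ts)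
      (ts.trans (union_subset g3 n3))
      (by rw [integral_sub gi (ni.const_mul m), integral_const_mul, η.integral_normed]; simp [hm])
    have e := h ψ p1 p2 p3
    have z0 : ∫ x in Ioo (0 : ℝ) 1, (0 : L2Omega) x * ψ x = 0 := by
      refine integral_eq_zero_of_ae ?_
      filter_upwards [Lp.coeFn_zero ℝ 2 muOmega] with x hx
      simp only [hx, Pi.zero_apply, zero_mul]
    have i1 : Integrable (fun x => u x * g x) muOmega :=
      integrable_mul_of_bound u g1.continuous g2
    have i2 : Integrable (fun x => u x * η.normed volume x) muOmega :=
      integrable_mul_of_bound u n1.continuous n2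
    have mg : ∫ x in Ioo (0 : ℝ) 1, g x = m :=
      setIntegral_eq_integral_of_forall_compl_eq_zero fun x hx =>
        image_eq_zero_of_notMem_tsupport fun k => hx (g3 k)
    have e2 : (∫ x in Ioo (0 : ℝ) 1, u x * g x) - m * c = 0 := by
      rw [z0, neg_zero, p4] at e
      refine Eq.trans ?_ e
      rw [hc, ← integral_const_mul, ← integral_sub i1 (i2.const_mul m)]
      refine integral_congr_ae (Filter.Eventually.of_forall fun x => ?_)
      simp only
      ring
    refine Eq.trans ?_ e2
    rw [← mg, ← integral_mul_const, ← integral_sub i1 (gi.restrict.mul_const c)]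
    refine integral_congr_ae (Filter.Eventually.of_forall fun x => ?_)
    simp only [smul_eq_mul]
    ring
  have hae : ∀ᵐ x ∂muOmega, x ∈ Ioo (0 : ℝ) 1 → u x - c = 0 :=
    isOpen_Ioo.ae_eq_zero_of_integral_contDiff_smul_eq_zero
      ((hu.sub (integrable_const c)).locallyIntegrable.locallyIntegrableOn _) key
  have huc : ∀ᵐ x ∂muOmega, u x = c := by
    filter_upwards [hae, ae_restrict_mem measurableSet_Ioo] with x h1 h2
    exact sub_eq_zero.1 (h1 h2)
  obtain ⟨f, hf, hf0, huf⟩ := hv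
  have hfc : f =ᵐ[volume.restrict (Icc (0 : ℝ) 1)] fun _ => c := by
    rw [← Measure.restrict_congr_set (Ioo_ae_eq_Icc (μ := volume) (a := (0 : ℝ)) (b := 1))]
    filter_upwards [huc, huf] with x h1 h2
    rw [← h2, h1]
  have h0 := Measure.eqOn_Icc_of_ae_eq volume (by norm_num) hfc hf continuousOn_const
    (left_mem_Icc.2 zero_le_one)
  have hc0 : c = 0 := by rw [← hf0]; exact h0.symm
  refine Lp.ext ?_
  filter_upwards [huc, Lp.coeFn_zero ℝ 2 muOmega] with x h1 h2
  rw [h1, h2, hc0, Pi.zero_apply]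

/-- The graph of the weak derivative over `{z ∈ H¹(Ω) : z(0) = 0}`: the pairs `(z, ∂ₓz)`. -/
def h1ZeroGraph : Submodule ℝ (L2Omega × L2Omega) where
  carrier := {p | IsWeakDeriv p.1 p.2 ∧ VanishesAtZero p.1}
  add_mem' := by
    rintro p q ⟨hp, f, hf, hf0, hpf⟩ ⟨hq, g, hg, hg0, hqg⟩
    refine ⟨isWeakDeriv_add hp hq, f + g, hf.add hg, by simp [hf0, hg0], ?_⟩
    exact (Lp.coeFn_add p.1 q.1).trans (hpf.add hqg)
  zero_mem' := ⟨isWeakDeriv_zero, 0, continuousOn_const, rfl, Lp.coeFn_zero ℝ 2 muOmega⟩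
  smul_mem' := by
    rintro c p ⟨hp, f, hf, hf0, hpf⟩
    refine ⟨isWeakDeriv_smul c hp, c • f, hf.const_smul c, by simp [hf0], ?_⟩
    exact (Lp.coeFn_smul c p.1).trans (hpf.const_smul c)

/-- The space `H¹₍₀₎(Ω) = {z ∈ H¹(Ω) : z(0) = 0}`. An element is stored together with its weak
derivative, which it determines. -/
def H1Zero : Type := h1ZeroGraph

instance : AddCommGroup H1Zero := inferInstanceAs (AddCommGroup h1ZeroGraph)

instance : Module ℝ H1Zero := inferInstanceAs (Module ℝ h1ZeroGraph)

/-- The inclusion `H¹₍₀₎(Ω) → L²(Ω)`. -/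
def H1Zero.toL2 : H1Zero →ₗ[ℝ] L2Omega :=
  (LinearMap.fst ℝ L2Omega L2Omega).comp h1ZeroGraph.subtype

/-- The derivative `∂ₓ : H¹₍₀₎(Ω) → L²(Ω)`. -/
def H1Zero.dx : H1Zero →ₗ[ℝ] L2Omega :=
  (LinearMap.snd ℝ L2Omega L2Omega).comp h1ZeroGraph.subtype

theorem H1Zero.dx_injective : Function.Injective H1Zero.dx := by
  rw [injective_iff_map_eq_zero]
  rintro ⟨⟨u, v⟩, hw, hv⟩ h
  have h' : v = 0 := h
  subst h'
  have hu : u = 0 := eq_zero_of_isWeakDeriv_zero hw hv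
  subst hu
  rfl

/-- `H¹₍₀₎(Ω)` carries the norm `‖z‖ = ‖∂ₓz‖_{L²(Ω)}`. -/
instance : NormedAddCommGroup H1Zero :=
  NormedAddCommGroup.induced H1Zero L2Omega H1Zero.dx H1Zero.dx_injective

instance : NormedSpace ℝ H1Zero := NormedSpace.induced ℝ H1Zero L2Omega H1Zero.dx

/-- `H⁻¹₍₀₎(Ω)`, the dual space of `H¹₍₀₎(Ω)` with the dual norm. -/
abbrev HNegOne : Type := StrongDual ℝ H1Zero

/-- `w` is the weak solution on `(0,T)` of the backward problem
`∂ₜₜw - ∂ₓₓw + A w = g` in `Q_T`, `w(0,·) = 0`, `∂ₓw(1,·) = 0`, `(w, ∂ₜw)(·,T) = (0,0)`,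
in the class `C⁰([0,T]; H¹₍₀₎) ∩ C¹([0,T]; L²) ∩ H²(0,T; H⁻¹₍₀₎)`; `w'` is `∂ₜw`. -/
structure IsBackwardWeakSolution (T : ℝ) (A : LinfCyl T) (g : L2Cyl T)
    (w : ℝ → H1Zero) (w' : ℝ → L2Omega) : Prop where
  continuousOn : ContinuousOn w (Icc 0 T)
  hasDeriv : ∀ t ∈ Icc 0 T, HasDerivWithinAt (fun s => (w s).toL2) (w' t) (Icc 0 T) t
  continuousOn_deriv : ContinuousOn w' (Icc 0 T)
  /-- `w''` is the second time derivative `∂ₜₜw ∈ L²(0,T; H⁻¹₍₀₎)`: as an `H⁻¹₍₀₎`-valued function,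
  `∂ₜw` is a primitive of `w''`. The equation holds in variational form for a.e. `t`. -/
  equation : ∃ w'' : ℝ → HNegOne, MemLp w'' 2 (volume.restrict (Ioo 0 T)) ∧
    (∀ t ∈ Icc 0 T, ∀ z : H1Zero,
      ∫ x in Ioo (0 : ℝ) 1, w' t x * z.toL2 x
        = (∫ x in Ioo (0 : ℝ) 1, w' 0 x * z.toL2 x) + (∫ s in (0 : ℝ)..t, w'' s) z) ∧
    ∀ᵐ t ∂(volume.restrict (Ioo 0 T)), ∀ z : H1Zero,
      w'' t z + (∫ x in Ioo (0 : ℝ) 1, (w t).dx x * z.dx x)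
          + (∫ x in Ioo (0 : ℝ) 1, A (x, t) * (w t).toL2 x * z.toL2 x)
        = ∫ x in Ioo (0 : ℝ) 1, g (x, t) * z.toL2 x
  final : w T = 0
  final_deriv : w' T = 0

/-- `φ ∈ L²(Q_T)` is a solution in the sense of transposition of
`∂ₜₜφ - ∂ₓₓφ + A φ = B` in `Q_T`, `φ(0,·) = 0`, `∂ₓφ(1,·) = 0`, `(φ, ∂ₜφ)(·,0) = (φ₀, φ₁)`. -/
def IsTranspositionSolution (T : ℝ) (A : LinfCyl T) (B : L2Cyl T)
    (φ₀ : L2Omega) (φ₁ : HNegOne) (φ : L2Cyl T) : Prop :=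
  ∀ (g : L2Cyl T) (w : ℝ → H1Zero) (w' : ℝ → L2Omega), IsBackwardWeakSolution T A g w w' →
    ∫ p in cyl T, φ p * g p
      = (∫ t in Ioo (0 : ℝ) T, ∫ x in Ioo (0 : ℝ) 1, B (x, t) * (w t).toL2 x)
        + φ₁ (w 0) - ∫ x in Ioo (0 : ℝ) 1, φ₀ x * w' 0 x

/-- `θ ∈ L²(0,T)` is the trace `φ(1,·)` of `φ ∈ L²(Q_T)`: `φ` coincides almost everywhere with some
`Φ ∈ C⁰([0,1]; L²(0,T))`, `x ↦ φ(x,·)`, and `θ = Φ(1)`. -/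
def IsTraceAtOne (T : ℝ) (φ : L2Cyl T) (θ : L2Time T) : Prop :=
  ∃ Φ : ℝ → L2Time T, ContinuousOn Φ (Icc 0 1) ∧
    (∀ᵐ x ∂muOmega, Φ x =ᵐ[volume.restrict (Ioo 0 T)] fun t => φ (x, t)) ∧ Φ 1 = θ

end HiddenReg

end

/-! The functions `√2 sin (ωₖ x)` with `ωₖ = (k + 1/2) π` form a Hilbert basis of `L²(Ω)`. Testing
the transposition identity with `w(x,t) = θ(t) √2 sin (ωₖ x)` shows that the `k`-th coefficient of
`φ` is a free wave minus the Duhamel integral of the `k`-th coefficient of `A φ`. In the time weight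
`e^{-lt}` with `l = √(2‖A‖ + 1)` the Duhamel operator has norm at most `1 / l²`, so the potential is
absorbed and `‖φ‖ ≤ C e^{C √‖A‖} (‖φ₀‖² + ‖φ₁‖²)^{1/2}`.

For fixed `x` the free waves are pairwise orthogonal over `(0, 2m)`, since all the sums and
differences of the frequencies are multiples of `π`, and the Duhamel terms are handled by the
Cauchy-Schwarz inequality and `∑ 1 / ωₖ² < ∞`. Hence blocks of the expansion of `φ(x, ·)` are
bounded in `L²(0,T)`, uniformly in `x`, by blocks of a convergent series: the expansion converges
uniformly to an element of `C([0,1]; L²(0,T))`, which coincides with `φ`. -/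

noncomputable section

namespace HiddenReg

open MeasureTheory Set Filter Topology

/-! ### Integration -/

section Intervals

variable {E : Type*} [NormedAddCommGroup E] {a b : ℝ}

theorem intervalIntegrable_of_integrableOn_Ioo {f : ℝ → E} {s t : ℝ}
    (hf : IntegrableOn f (Ioo a b)) (hs : s ∈ Icc a b) (ht : t ∈ Icc a b) :
    IntervalIntegrable f volume s t :=
  (((integrableOn_Icc_iff_integrableOn_Ioo (by simp) (by simp)).2 hf).mono_set
    (uIcc_subset_Icc hs ht)).intervalIntegrable

theorem memLp_restrict_Ioo_of_continuousOn {f : ℝ → E} {p : ENNReal}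
    (hf : ContinuousOn f (Icc a b)) : MemLp f p (volume.restrict (Ioo a b)) := by
  obtain ⟨C, hC⟩ := isCompact_Icc.exists_bound_of_continuousOn hf
  exact MemLp.of_bound ((hf.mono Ioo_subset_Icc_self).aestronglyMeasurable measurableSet_Ioo) C
    (ae_restrict_of_forall_mem measurableSet_Ioo fun x hx => hC x (Ioo_subset_Icc_self hx))

theorem integrable_indicator_lt {F : ℝ → ℝ → E}
    (hF : IntegrableOn (Function.uncurry F) (Ioo a b ×ˢ Ioo a b)) :
    Integrable ({p : ℝ × ℝ | p.2 < p.1}.indicator (Function.uncurry F))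
      ((volume.restrict (Ioo a b)).prod (volume.restrict (Ioo a b))) := by
  rw [Measure.prod_restrict]
  exact hF.indicator (measurableSet_lt measurable_snd measurable_fst)

variable [NormedSpace ℝ E]

theorem intervalIntegral_eq_integral_Ioo (hab : a ≤ b) (f : ℝ → E) :
    ∫ x in a..b, f x = ∫ x in Ioo a b, f x := by
  rw [intervalIntegral.integral_of_le hab, integral_Ioc_eq_integral_Ioo]

theorem continuousOn_integral_of_integrableOn_Ioo {f : ℝ → E} (hf : IntegrableOn f (Ioo a b)) :
    ContinuousOn (fun x => ∫ s in a..x, f s) (Icc a b) := by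
  rcases le_or_gt a b with hab | hab
  · have hcont := intervalIntegral.continuousOn_primitive_interval (f := f) (a := a) (b := b)
      (μ := volume)
    rw [uIcc_of_le hab] at hcont
    exact hcont ((integrableOn_Icc_iff_integrableOn_Ioo (by simp) (by simp)).2 hf)
  · simp [Icc_eq_empty hab.not_ge]

theorem intervalIntegral_eq_integral_indicator_lt {F : ℝ → ℝ → E} {x : ℝ} (hx : x ∈ Ioo a b) :
    ∫ s in a..x, F x s
      = ∫ s in Ioo a b, {p : ℝ × ℝ | p.2 < p.1}.indicator (Function.uncurry F) (x, s) := by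
  have hF : (fun s => {p : ℝ × ℝ | p.2 < p.1}.indicator (Function.uncurry F) (x, s))
      = (Iio x).indicator (F x) := rfl
  rw [hF, setIntegral_indicator measurableSet_Iio, Ioo_inter_Iio, min_eq_right hx.2.le,
    intervalIntegral_eq_integral_Ioo hx.1.le]

theorem intervalIntegral_eq_integral_indicator_gt {F : ℝ → ℝ → E} {s : ℝ} (hs : s ∈ Ioo a b) :
    ∫ x in s..b, F x s
      = ∫ x in Ioo a b, {p : ℝ × ℝ | p.2 < p.1}.indicator (Function.uncurry F) (x, s) := by
  have hF : (fun x => {p : ℝ × ℝ | p.2 < p.1}.indicator (Function.uncurry F) (x, s))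
      = (Ioi s).indicator fun x => F x s := rfl
  rw [hF, setIntegral_indicator measurableSet_Ioi, Ioo_inter_Ioi, max_eq_right hs.1.le,
    intervalIntegral_eq_integral_Ioo hs.2.le]

theorem integrableOn_intervalIntegral {F : ℝ → ℝ → E}
    (hF : IntegrableOn (Function.uncurry F) (Ioo a b ×ˢ Ioo a b)) :
    IntegrableOn (fun x => ∫ s in a..x, F x s) (Ioo a b) :=
  IntegrableOn.congr_fun (integrable_indicator_lt hF).integral_prod_left
    (fun _ hx => (intervalIntegral_eq_integral_indicator_lt hx).symm) measurableSet_Ioo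

theorem integral_intervalIntegral_swap {F : ℝ → ℝ → E}
    (hF : IntegrableOn (Function.uncurry F) (Ioo a b ×ˢ Ioo a b)) :
    ∫ x in Ioo a b, ∫ s in a..x, F x s = ∫ s in Ioo a b, ∫ x in s..b, F x s := by
  rw [setIntegral_congr_fun measurableSet_Ioo
      fun _ hx => intervalIntegral_eq_integral_indicator_lt hx,
    setIntegral_congr_fun measurableSet_Ioo
      fun _ hs => intervalIntegral_eq_integral_indicator_gt hs]
  exact integral_integral_swap (integrable_indicator_lt hF)

end Intervals

theorem integrableOn_prod_continuous_mul_snd {a b : ℝ} {c : ℝ → ℝ → ℝ} {v : ℝ → ℝ}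
    (hc : Continuous (Function.uncurry c)) (hv : IntegrableOn v (Ioo a b)) :
    IntegrableOn (Function.uncurry fun x s => c x s * v s) (Ioo a b ×ˢ Ioo a b) := by
  refine IntegrableOn.continuousOn_mul_of_subset (K := Icc a b ×ˢ Icc a b) hc.continuousOn ?_
    (isCompact_Icc.prod isCompact_Icc) (measurableSet_Ioo.prod measurableSet_Ioo)
    (prod_mono Ioo_subset_Icc_self Ioo_subset_Icc_self)
  rw [IntegrableOn, Measure.volume_eq_prod, ← Measure.prod_restrict]
  exact Integrable.comp_snd hv _

theorem sq_integral_mul_le {α : Type*} [MeasurableSpace α] {μ : Measure α} {κ v : α → ℝ}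
    (hκ : Integrable κ μ) (hκ0 : 0 ≤ᵐ[μ] κ) (hκv : Integrable (fun x => κ x * v x) μ)
    (hκv2 : Integrable (fun x => κ x * v x ^ 2) μ) :
    (∫ x, κ x * v x ∂μ) ^ 2 ≤ (∫ x, κ x ∂μ) * ∫ x, κ x * v x ^ 2 ∂μ := by
  have hquad : ∀ r : ℝ, 0 ≤ (∫ x, κ x ∂μ) * (r * r) + (-2 * ∫ x, κ x * v x ∂μ) * r
      + ∫ x, κ x * v x ^ 2 ∂μ := fun r => by
    have hexpand : ∫ x, κ x * (r - v x) ^ 2 ∂μ = (∫ x, κ x ∂μ) * (r * r)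
        + (-2 * ∫ x, κ x * v x ∂μ) * r + ∫ x, κ x * v x ^ 2 ∂μ := by
      have hsq : ∀ x, κ x * (r - v x) ^ 2
          = κ x * (r * r) + -2 * (κ x * v x) * r + κ x * v x ^ 2 := fun x => by ring
      have hconst := hκ.mul_const (r * r)
      have hlin := (hκv.const_mul (-2)).mul_const r
      simp only [hsq]
      rw [integral_add (hconst.fun_add hlin) hκv2, integral_add hconst hlin, integral_mul_const,
        integral_mul_const, integral_const_mul]
    rw [← hexpand]
    exact integral_nonneg_of_ae (hκ0.mono fun x hx => mul_nonneg hx (sq_nonneg _))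
  have := discrim_le_zero hquad
  unfold discrim at this
  linarith

section Young

variable {T : ℝ} {k v : ℝ → ℝ}

theorem sq_integral_convolution_le (hk : Continuous k)
    (hv : MemLp v 2 (volume.restrict (Ioo 0 T))) {t : ℝ} (ht : t ∈ Ioo 0 T) :
    (∫ s in (0 : ℝ)..t, k (t - s) * v s) ^ 2
      ≤ (∫ r in (0 : ℝ)..T, |k r|) * ∫ s in (0 : ℝ)..t, |k (t - s)| * v s ^ 2 := by
  have hsub : Ioo 0 t ⊆ Ioo 0 T := Ioo_subset_Ioo_right ht.2.le
  have hmul : ∀ {f : ℝ → ℝ}, IntegrableOn f (Ioo 0 T) →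
      IntegrableOn (fun s => |k (t - s)| * f s) (Ioo 0 t) := fun hf =>
    (hf.mono_set hsub).continuousOn_mul_of_subset (K := Icc 0 t) (by fun_prop) isCompact_Icc
      measurableSet_Ioo Ioo_subset_Icc_self
  have hkern : ∫ s in Ioo 0 t, |k (t - s)| ≤ ∫ r in (0 : ℝ)..T, |k r| := by
    rw [← intervalIntegral_eq_integral_Ioo ht.1.le,
      intervalIntegral.integral_comp_sub_left (fun r => |k r|) t, sub_self, sub_zero]
    exact intervalIntegral.integral_mono_interval le_rfl ht.1.le ht.2.le
      (Eventually.of_forall fun r => abs_nonneg _) (hk.abs.intervalIntegrable _ _)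
  simp only [intervalIntegral_eq_integral_Ioo ht.1.le]
  calc (∫ s in Ioo 0 t, k (t - s) * v s) ^ 2
      ≤ (∫ s in Ioo 0 t, |k (t - s)| * |v s|) ^ 2 := by
        rw [← sq_abs]
        refine pow_le_pow_left₀ (abs_nonneg _) ?_ 2
        simpa only [abs_mul] using abs_integral_le_integral_abs
          (f := fun s => k (t - s) * v s) (μ := volume.restrict (Ioo 0 t))
    _ ≤ (∫ s in Ioo 0 t, |k (t - s)|) * ∫ s in Ioo 0 t, |k (t - s)| * |v s| ^ 2 :=
        sq_integral_mul_le
          ((by fun_prop : Continuous fun s => |k (t - s)|).integrableOn_Ioc.mono_set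
            Ioo_subset_Ioc_self)
          (Eventually.of_forall fun s => abs_nonneg _) (hmul (hv.integrable one_le_two).abs)
          (hmul (f := fun s => |v s| ^ 2) hv.norm.integrable_sq)
    _ ≤ (∫ r in (0 : ℝ)..T, |k r|) * ∫ s in Ioo 0 t, |k (t - s)| * v s ^ 2 := by
        simp only [sq_abs]
        refine mul_le_mul_of_nonneg_right hkern (integral_nonneg fun s => ?_)
        positivity

theorem integral_sq_convolution_le (hT : 0 ≤ T) (hk : Continuous k)
    (hv : MemLp v 2 (volume.restrict (Ioo 0 T))) :
    ∫ t in Ioo 0 T, (∫ s in (0 : ℝ)..t, k (t - s) * v s) ^ 2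
      ≤ (∫ r in (0 : ℝ)..T, |k r|) ^ 2 * ∫ t in Ioo 0 T, v t ^ 2 := by
  set M := ∫ r in (0 : ℝ)..T, |k r|
  have hM : 0 ≤ M := intervalIntegral.integral_nonneg hT fun r _ => abs_nonneg _
  have hintegrable := integrableOn_prod_continuous_mul_snd (c := fun t s => |k (t - s)|)
    (by fun_prop) hv.integrable_sq
  have hkern : ∀ s ∈ Ioo 0 T, ∫ t in s..T, |k (t - s)| ≤ M := fun s hs => by
    rw [intervalIntegral.integral_comp_sub_right (fun r => |k r|) s, sub_self]
    exact intervalIntegral.integral_mono_interval le_rfl (sub_nonneg.2 hs.2.le)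
      (sub_le_self _ hs.1.le) (Eventually.of_forall fun r => abs_nonneg _)
      (hk.abs.intervalIntegrable _ _)
  calc ∫ t in Ioo 0 T, (∫ s in (0 : ℝ)..t, k (t - s) * v s) ^ 2
      ≤ ∫ t in Ioo 0 T, M * ∫ s in (0 : ℝ)..t, |k (t - s)| * v s ^ 2 :=
        integral_mono_of_nonneg (Eventually.of_forall fun t => sq_nonneg _)
          ((integrableOn_intervalIntegral hintegrable).const_mul M)
          (ae_restrict_of_forall_mem measurableSet_Ioo fun t ht =>
            sq_integral_convolution_le hk hv ht)
    _ = M * ∫ s in Ioo 0 T, (∫ t in s..T, |k (t - s)|) * v s ^ 2 := by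
        simp only [integral_const_mul, integral_intervalIntegral_swap hintegrable,
          intervalIntegral.integral_mul_const]
    _ ≤ M * ∫ s in Ioo 0 T, M * v s ^ 2 := by
        refine mul_le_mul_of_nonneg_left (integral_mono_of_nonneg ?_
          (hv.integrable_sq.const_mul M) ?_) hM
        · exact ae_restrict_of_forall_mem measurableSet_Ioo fun s hs => mul_nonneg
            (intervalIntegral.integral_nonneg hs.2.le fun t _ => abs_nonneg _) (sq_nonneg _)
        · exact ae_restrict_of_forall_mem measurableSet_Ioo fun s hs =>
            mul_le_mul_of_nonneg_right (hkern s hs) (sq_nonneg _)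
    _ = M ^ 2 * ∫ t in Ioo 0 T, v t ^ 2 := by rw [integral_const_mul]; ring

end Young

section L2

variable {α : Type*} [MeasurableSpace α] {μ : Measure α}

theorem inner_eq_integral_of_ae_eq {u v : Lp ℝ 2 μ} {f g : α → ℝ} (hf : u =ᵐ[μ] f)
    (hg : v =ᵐ[μ] g) : inner ℝ u v = ∫ x, f x * g x ∂μ := by
  rw [L2.inner_def]
  refine integral_congr_ae ?_
  filter_upwards [hf, hg] with x hfx hgx
  rw [hfx, hgx, RCLike.inner_apply, conj_trivial, mul_comm]

theorem norm_sq_eq_integral_of_ae_eq {u : Lp ℝ 2 μ} {f : α → ℝ} (hf : u =ᵐ[μ] f) :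
    ‖u‖ ^ 2 = ∫ x, f x ^ 2 ∂μ := by
  rw [← real_inner_self_eq_norm_sq, inner_eq_integral_of_ae_eq hf hf]
  simp only [sq]

end L2

theorem ae_eq_of_integral_continuous_mul_eq {a b : ℝ} {u v : ℝ → ℝ}
    (hu : IntegrableOn u (Ioo a b)) (hv : IntegrableOn v (Ioo a b))
    (h : ∀ q : ℝ → ℝ, Continuous q → ∫ x in Ioo a b, q x * u x = ∫ x in Ioo a b, q x * v x) :
    u =ᵐ[volume.restrict (Ioo a b)] v := by
  have hzero : ∀ᵐ x ∂volume.restrict (Ioo a b), x ∈ Ioo a b → u x - v x = 0 := by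
    refine isOpen_Ioo.ae_eq_zero_of_integral_contDiff_smul_eq_zero
      ((Integrable.sub hu hv).locallyIntegrable.locallyIntegrableOn _) fun q hq _ _ => ?_
    have hmul : ∀ {f : ℝ → ℝ}, IntegrableOn f (Ioo a b) →
        IntegrableOn (fun x => q x * f x) (Ioo a b) := fun hf =>
      hf.continuousOn_mul_of_subset hq.continuous.continuousOn isCompact_Icc measurableSet_Ioo
        Ioo_subset_Icc_self
    simp only [smul_eq_mul, mul_sub]
    rw [integral_sub (hmul hu) (hmul hv), h q hq.continuous, sub_self]
  filter_upwards [hzero, ae_restrict_mem measurableSet_Ioo] with x hx hmem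
  exact sub_eq_zero.1 (hx hmem)

section Prod

variable {α β : Type*} [MeasurableSpace α] [MeasurableSpace β] {μ : Measure α} {ν : Measure β}
  [SFinite μ] [SFinite ν]

theorem ae_ae_of_ae_prod_swap {p : α × β → Prop} (h : ∀ᵐ z ∂μ.prod ν, p z) :
    ∀ᵐ y ∂ν, ∀ᵐ x ∂μ, p (x, y) :=
  Measure.ae_ae_of_ae_prod (Measure.measurePreserving_swap.quasiMeasurePreserving.ae h)

theorem memLp_two_section {f : α × β → ℝ} (hf : MemLp f 2 (μ.prod ν)) :
    ∀ᵐ y ∂ν, MemLp (fun x => f (x, y)) 2 μ := by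
  filter_upwards [hf.aestronglyMeasurable.prodMk_right, hf.integrable_sq.prod_left_ae]
    with y hmeas hsq
  exact (memLp_two_iff_integrable_sq hmeas).2 hsq

end Prod

section Moments

variable {α : Type*} [MeasurableSpace α] {μ : Measure α} {F u : α → ℝ} {a b : ℝ}

theorem integrable_mul_continuous_comp (hF : Integrable F μ) (hu : AEStronglyMeasurable u μ)
    (hmem : ∀ᵐ x ∂μ, u x ∈ Icc a b) {g : ℝ → ℝ} (hg : Continuous g) :
    Integrable (fun x => F x * g (u x)) μ := by
  obtain ⟨C, hC⟩ := isCompact_Icc.exists_bound_of_continuousOn (hg.continuousOn (s := Icc a b))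
  exact hF.mul_bdd (hg.comp_aestronglyMeasurable hu) (hmem.mono fun x hx => hC _ hx)

theorem integral_mul_polynomial_comp_eq_zero (hF : Integrable F μ)
    (hu : AEStronglyMeasurable u μ) (hmem : ∀ᵐ x ∂μ, u x ∈ Icc a b)
    (hpow : ∀ n : ℕ, ∫ x, F x * u x ^ n ∂μ = 0) (p : Polynomial ℝ) :
    ∫ x, F x * p.eval (u x) ∂μ = 0 := by
  induction p using Polynomial.induction_on' with
  | add p q hp hq =>
    simp only [Polynomial.eval_add, mul_add]
    rw [integral_add (integrable_mul_continuous_comp hF hu hmem p.continuous)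
      (integrable_mul_continuous_comp hF hu hmem q.continuous), hp, hq, add_zero]
  | monomial n c =>
    simp only [Polynomial.eval_monomial, mul_left_comm _ c, integral_const_mul, hpow, mul_zero]

theorem integral_mul_comp_eq_zero_of_moments (hF : Integrable F μ)
    (hu : AEStronglyMeasurable u μ) (hmem : ∀ᵐ x ∂μ, u x ∈ Icc a b)
    (hpow : ∀ n : ℕ, ∫ x, F x * u x ^ n ∂μ = 0) {g : ℝ → ℝ} (hg : Continuous g) :
    ∫ x, F x * g (u x) ∂μ = 0 := by
  set M := ∫ x, |F x| ∂μ
  have hM : 0 ≤ M := integral_nonneg fun x => abs_nonneg _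
  refine abs_nonpos_iff.1 (le_of_forall_pos_le_add fun δ hδ => ?_)
  obtain ⟨p, hp⟩ := exists_polynomial_near_of_continuousOn a b g hg.continuousOn (δ / (M + 1))
    (by positivity)
  have hFg := integrable_mul_continuous_comp hF hu hmem hg
  have hFp := integrable_mul_continuous_comp hF hu hmem p.continuous
  have hbound : ∀ᵐ x ∂μ, |F x * g (u x) - F x * p.eval (u x)| ≤ δ / (M + 1) * |F x| :=
    hmem.mono fun x hx => by
      rw [← mul_sub, abs_mul, abs_sub_comm, mul_comm]
      exact mul_le_mul_of_nonneg_right (hp _ hx).le (abs_nonneg _)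
  calc |∫ x, F x * g (u x) ∂μ|
      = |∫ x, (F x * g (u x) - F x * p.eval (u x)) ∂μ| := by
        rw [integral_sub hFg hFp, integral_mul_polynomial_comp_eq_zero hF hu hmem hpow, sub_zero]
    _ ≤ ∫ x, |F x * g (u x) - F x * p.eval (u x)| ∂μ := abs_integral_le_integral_abs
    _ ≤ ∫ x, δ / (M + 1) * |F x| ∂μ :=
        integral_mono_ae (hFg.sub hFp).abs (hF.abs.const_mul _) hbound
    _ ≤ 0 + δ := by
        rw [integral_const_mul, zero_add, div_mul_eq_mul_div, div_le_iff₀ (by positivity)]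
        nlinarith [hM]

end Moments

theorem ae_eq_zero_of_tendsto_integral {α : Type*} [MeasurableSpace α] {μ : Measure α}
    {g : ℕ → α → ℝ} {h : α → ℝ} (hg : ∀ n, Integrable (g n) μ) (hg_nonneg : ∀ n x, 0 ≤ g n x)
    (hlim : Tendsto (fun n => ∫ x, g n x ∂μ) atTop (𝓝 0))
    (hgh : ∀ᵐ x ∂μ, Tendsto (fun n => g n x) atTop (𝓝 (h x))) : h =ᵐ[μ] 0 := by
  have hnorm : Tendsto (fun n => eLpNorm (g n - 0) 1 μ) atTop (𝓝 0) := by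
    have heLpNorm : ∀ n, eLpNorm (g n - 0) 1 μ = ENNReal.ofReal (∫ x, g n x ∂μ) := by
      intro n
      rw [sub_zero, eLpNorm_one_eq_lintegral_enorm,
        ← ofReal_integral_norm_eq_lintegral_enorm (hg n)]
      simp only [Real.norm_eq_abs, abs_of_nonneg (hg_nonneg n _)]
    simp only [heLpNorm]
    exact ENNReal.ofReal_zero ▸ ENNReal.tendsto_ofReal hlim
  obtain ⟨ns, hns, hae⟩ := (tendstoInMeasure_of_tendsto_eLpNorm one_ne_zero
    (fun n => (hg n).aestronglyMeasurable) aestronglyMeasurable_zero hnorm).exists_seq_tendsto_ae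
  filter_upwards [hgh, hae] with x hx hx_zero
  exact tendsto_nhds_unique (hx.comp hns.tendsto_atTop) hx_zero

/-! ### Sums in Hilbert spaces -/

theorem norm_sub_sum_inner_smul_sq {ι E : Type*} [NormedAddCommGroup E] [InnerProductSpace ℝ E]
    {e : ι → E} (he : Orthonormal ℝ e) (u : E) (s : Finset ι) :
    ‖u - ∑ k ∈ s, inner ℝ (e k) u • e k‖ ^ 2 = ‖u‖ ^ 2 - ∑ k ∈ s, inner ℝ (e k) u ^ 2 := by
  have hcross : inner ℝ u (∑ k ∈ s, inner ℝ (e k) u • e k) = ∑ k ∈ s, inner ℝ (e k) u ^ 2 := by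
    simp only [inner_sum, real_inner_smul_right, real_inner_comm, sq]
  have hnorm : ‖∑ k ∈ s, inner ℝ (e k) u • e k‖ ^ 2 = ∑ k ∈ s, inner ℝ (e k) u ^ 2 := by
    rw [← real_inner_self_eq_norm_sq, he.inner_sum]
    simp only [conj_trivial, sq]
  rw [norm_sub_sq_real, hcross, hnorm]
  ring

theorem sum_sq_apply_le_norm_sq {ι E : Type*} [NormedAddCommGroup E] [NormedSpace ℝ E] {e : ι → E}
    {s : Finset ι} (he : ∀ a : ι → ℝ, ‖∑ i ∈ s, a i • e i‖ ^ 2 ≤ ∑ i ∈ s, a i ^ 2)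
    (φ : StrongDual ℝ E) : ∑ i ∈ s, φ (e i) ^ 2 ≤ ‖φ‖ ^ 2 := by
  set y := ∑ i ∈ s, φ (e i) • e i
  have hy : ‖y‖ ^ 2 ≤ ∑ i ∈ s, φ (e i) ^ 2 := he _
  have hφy : φ y = ∑ i ∈ s, φ (e i) ^ 2 := by simp [y, sq]
  have hle : φ y ≤ ‖φ‖ * ‖y‖ := (le_abs_self _).trans (φ.le_opNorm y)
  nlinarith [sq_nonneg (‖φ‖ - ‖y‖)]

section LpSums

variable {ι α : Type*} [MeasurableSpace α] {μ : Measure α} {f : ι → α → ℝ}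

theorem sum_smul_toLp_ae_eq (hf : ∀ k, MemLp (f k) 2 μ) (c : ι → ℝ) (s : Finset ι) :
    ⇑(∑ k ∈ s, c k • (hf k).toLp) =ᵐ[μ] fun t => ∑ k ∈ s, c k * f k t := by
  have hterm : ∀ᵐ t ∂μ, ∀ k ∈ s, (c k • (hf k).toLp : Lp ℝ 2 μ) t = c k * f k t := by
    refine s.eventually_all.2 fun k _ => ?_
    filter_upwards [Lp.coeFn_smul (c k) (hf k).toLp, (hf k).coeFn_toLp] with t hsmul htoLp
    rw [hsmul, Pi.smul_apply, htoLp, smul_eq_mul]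
  filter_upwards [Lp.coeFn_fun_finsetSum s fun k => c k • (hf k).toLp, hterm] with t hsum ht
  rw [hsum, Finset.sum_congr rfl ht]

theorem integral_sub_sq_le {g h : α → ℝ} (hg : MemLp g 2 μ) (hh : MemLp h 2 μ) :
    ∫ t, (g t - h t) ^ 2 ∂μ ≤ 2 * (∫ t, g t ^ 2 ∂μ) + 2 * ∫ t, h t ^ 2 ∂μ := by
  have hg_sq := hg.integrable_sq.const_mul 2
  have hh_sq := hh.integrable_sq.const_mul 2
  rw [← integral_const_mul, ← integral_const_mul, ← integral_add hg_sq hh_sq]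
  refine integral_mono (hg.sub hh).integrable_sq (hg_sq.add hh_sq) fun t => ?_
  change (g t - h t) ^ 2 ≤ 2 * g t ^ 2 + 2 * h t ^ 2
  linarith only [sq_nonneg (g t + h t)]

theorem norm_sq_toLp_sub_of_ae_eq {g h : α → ℝ} (hg : MemLp g 2 μ) {u : Lp ℝ 2 μ}
    (hu : u =ᵐ[μ] h) : ‖hg.toLp - u‖ ^ 2 = ∫ t, (g t - h t) ^ 2 ∂μ :=
  norm_sq_eq_integral_of_ae_eq ((Lp.coeFn_sub _ _).trans (hg.coeFn_toLp.sub hu))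

end LpSums

section UniformConvergence

variable {X E : Type*} [NormedAddCommGroup E] {f : ℕ → X → E} {K : Set X} {d : ℕ → ℝ}

theorem uniformCauchySeqOn_sum_of_norm_sq_le (hd : Summable d)
    (hfd : ∀ s : Finset ℕ, ∀ x ∈ K, ‖∑ k ∈ s, f k x‖ ^ 2 ≤ ∑ k ∈ s, d k) :
    UniformCauchySeqOn (fun N x => ∑ k ∈ Finset.range N, f k x) atTop K := by
  rw [Metric.uniformCauchySeqOn_iff]
  intro ε hε
  obtain ⟨N, hN⟩ :=
    Metric.cauchySeq_iff.1 hd.hasSum.tendsto_sum_nat.cauchySeq (ε ^ 2) (by positivity)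
  refine ⟨N, fun m hm n hn x hx => ?_⟩
  wlog hmn : m ≤ n generalizing m n
  · rw [dist_comm]
    exact this n hn m hm (le_of_not_ge hmn)
  rw [dist_comm, dist_eq_norm, ← Finset.sum_Ico_eq_sub _ hmn]
  refine lt_of_pow_lt_pow_left₀ 2 hε.le ((hfd _ x hx).trans_lt ?_)
  rw [Finset.sum_Ico_eq_sub _ hmn]
  exact (le_abs_self _).trans_lt (hN n hn m hm)

theorem exists_continuousOn_tendsto_sum_of_norm_sq_le [TopologicalSpace X] [CompleteSpace E]
    (hf : ∀ k, ContinuousOn (f k) K) (hd : Summable d)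
    (hfd : ∀ s : Finset ℕ, ∀ x ∈ K, ‖∑ k ∈ s, f k x‖ ^ 2 ≤ ∑ k ∈ s, d k) :
    ∃ Φ : X → E, ContinuousOn Φ K ∧
      (∀ x ∈ K, Tendsto (fun N => ∑ k ∈ Finset.range N, f k x) atTop (𝓝 (Φ x))) ∧
      ∀ x ∈ K, ‖Φ x‖ ^ 2 ≤ ∑' k, d k := by
  have hcauchy := uniformCauchySeqOn_sum_of_norm_sq_le hd hfd
  have hlim : ∀ x ∈ K, Tendsto (fun N => ∑ k ∈ Finset.range N, f k x) atTop
      (𝓝 (limUnder atTop fun N => ∑ k ∈ Finset.range N, f k x)) := fun x hx =>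
    (hcauchy.cauchySeq hx).tendsto_limUnder
  refine ⟨_, ?_, hlim, fun x hx => ?_⟩
  · exact (hcauchy.tendstoUniformlyOn_of_tendsto hlim).continuousOn
      (.of_forall fun N => continuousOn_finsetSum _ fun k _ => hf k)
  · exact le_of_tendsto_of_tendsto' ((hlim x hx).norm.pow 2) hd.hasSum.tendsto_sum_nat
      fun N => hfd _ x hx

end UniformConvergence

/-! ### Eigenfunctions -/

theorem integrable_L2Omega (u : L2Omega) : Integrable u muOmega :=
  (Lp.memLp u).integrable one_le_two

theorem mem_h1ZeroGraph_of_ae_eq_integral {u v : L2Omega}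
    (h : u =ᵐ[muOmega] fun x => ∫ s in (0 : ℝ)..x, v s) : (u, v) ∈ h1ZeroGraph := by
  refine ⟨fun ψ hψ _ hsupp => ?_, _,
    continuousOn_integral_of_integrableOn_Ioo (integrable_L2Omega v), by simp, h⟩
  have hderiv : Continuous (deriv ψ) := hψ.continuous_deriv (by simp)
  have hψ1 : ψ 1 = 0 := image_eq_zero_of_notMem_tsupport fun hmem => lt_irrefl _ (hsupp hmem).2
  calc ∫ x in Ioo (0 : ℝ) 1, u x * deriv ψ x
      = ∫ x in Ioo (0 : ℝ) 1, ∫ s in (0 : ℝ)..x, deriv ψ x * v s := by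
        refine integral_congr_ae (h.mono fun x hx => ?_)
        simp only [hx, intervalIntegral.integral_const_mul, mul_comm]
    _ = ∫ s in Ioo (0 : ℝ) 1, ∫ x in s..1, deriv ψ x * v s :=
        integral_intervalIntegral_swap (integrableOn_prod_continuous_mul_snd
          (c := fun x _ => deriv ψ x) (hderiv.comp continuous_fst) (integrable_L2Omega v))
    _ = -∫ s in Ioo (0 : ℝ) 1, v s * ψ s := by
        rw [← integral_neg]
        congr 1; ext s
        rw [intervalIntegral.integral_mul_const, intervalIntegral.integral_deriv_eq_sub
          (fun x _ => (hψ.differentiable (by simp)).differentiableAt)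
          (hderiv.intervalIntegrable _ _), hψ1]
        ring

theorem H1Zero.toL2_ae_eq (z : H1Zero) :
    z.toL2 =ᵐ[muOmega] fun x => ∫ s in (0 : ℝ)..x, z.dx s := by
  have hprim : MemLp (fun x => ∫ s in (0 : ℝ)..x, z.dx s) 2 muOmega :=
    memLp_restrict_Ioo_of_continuousOn
      (continuousOn_integral_of_integrableOn_Ioo (integrable_L2Omega z.dx))
  have hz : (⟨_, mem_h1ZeroGraph_of_ae_eq_integral hprim.coeFn_toLp⟩ : H1Zero) = z :=
    H1Zero.dx_injective rfl
  have htoL2 : z.toL2 = hprim.toLp := (congrArg H1Zero.toL2 hz).symm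
  rw [htoL2]
  exact hprim.coeFn_toLp

theorem H1Zero.integral_mul_dx (z : H1Zero) {P p : ℝ → ℝ} (hp : Continuous p)
    (hP : ∀ x, HasDerivAt P (-p x) x) (hP1 : P 1 = 0) :
    ∫ x in Ioo (0 : ℝ) 1, P x * z.dx x = ∫ x in Ioo (0 : ℝ) 1, p x * z.toL2 x := by
  symm
  calc ∫ x in Ioo (0 : ℝ) 1, p x * z.toL2 x
      = ∫ x in Ioo (0 : ℝ) 1, ∫ s in (0 : ℝ)..x, p x * z.dx s := by
        refine integral_congr_ae (z.toL2_ae_eq.mono fun x hx => ?_)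
        simp only [hx, intervalIntegral.integral_const_mul]
    _ = ∫ s in Ioo (0 : ℝ) 1, ∫ x in s..1, p x * z.dx s :=
        integral_intervalIntegral_swap (integrableOn_prod_continuous_mul_snd
          (c := fun x _ => p x) (hp.comp continuous_fst) (integrable_L2Omega z.dx))
    _ = ∫ x in Ioo (0 : ℝ) 1, P x * z.dx x := by
        congr 1; ext s
        have hFTC : ∫ x in s..1, -p x = P 1 - P s :=
          intervalIntegral.integral_eq_sub_of_hasDerivAt (fun x _ => hP x)
            (hp.neg.intervalIntegrable _ _)
        rw [intervalIntegral.integral_neg, hP1] at hFTC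
        rw [intervalIntegral.integral_mul_const]
        linear_combination -z.dx s * hFTC

theorem integral_cos_int_mul_pi (n : ℤ) (m : ℕ) :
    ∫ t in (0 : ℝ)..m, Real.cos (n * Real.pi * t) = if n = 0 then (m : ℝ) else 0 := by
  split_ifs with hn
  · simp [hn]
  · have hn' : (n * Real.pi : ℝ) ≠ 0 := mul_ne_zero (by exact_mod_cast hn) Real.pi_ne_zero
    have hend : (n * Real.pi * m : ℝ) = ((n * m : ℤ) : ℝ) * Real.pi := by push_cast; ring
    rw [intervalIntegral.integral_comp_mul_left (fun x => Real.cos x) hn', integral_cos, hend,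
      Real.sin_int_mul_pi]
    simp

theorem integral_sin_int_mul_pi (n : ℤ) (m : ℕ) :
    ∫ t in (0 : ℝ)..(2 * m : ℕ), Real.sin (n * Real.pi * t) = 0 := by
  rcases eq_or_ne n 0 with rfl | hn
  · simp
  · have hn' : (n * Real.pi : ℝ) ≠ 0 := mul_ne_zero (by exact_mod_cast hn) Real.pi_ne_zero
    have hend : (n * Real.pi * (2 * m : ℕ) : ℝ) = ((n * m : ℤ) : ℝ) * (2 * Real.pi) := by
      push_cast; ring
    rw [intervalIntegral.integral_comp_mul_left (fun x => Real.sin x) hn', integral_sin, hend,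
      Real.cos_int_mul_two_pi]
    simp

/-- The frequencies `(k + 1/2) π` of the string on `(0,1)` fixed at `0` and free at `1`. -/
def freq (k : ℕ) : ℝ := (k + 1 / 2) * Real.pi

theorem succ_le_freq (k : ℕ) : (k : ℝ) + 1 ≤ freq k := by
  unfold freq
  nlinarith [Real.pi_gt_three, (Nat.cast_nonneg k : (0 : ℝ) ≤ k)]

theorem freq_pos (k : ℕ) : 0 < freq k :=
  lt_of_lt_of_le (by positivity) (succ_le_freq k)

theorem freq_ne_zero (k : ℕ) : freq k ≠ 0 := (freq_pos k).ne'

theorem sum_inv_freq_sq_le (s : Finset ℕ) :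
    ∑ k ∈ s, (freq k)⁻¹ ^ 2 ≤ ∑' k : ℕ, 1 / ((k : ℝ) + 1) ^ 2 := by
  have hsummable : Summable fun k : ℕ => 1 / ((k : ℝ) + 1) ^ 2 := by
    simpa using (summable_nat_add_iff 1).2 (Real.summable_one_div_nat_pow.2 one_lt_two)
  refine (Finset.sum_le_sum fun k _ => ?_).trans
    (hsummable.sum_le_tsum s fun k _ => by positivity)
  rw [inv_pow, ← one_div]
  have hfreq := succ_le_freq k
  gcongr

theorem cos_freq (k : ℕ) : Real.cos (freq k) = 0 :=
  Real.cos_eq_zero_iff.2 ⟨k, by unfold freq; push_cast; ring⟩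

theorem freq_sub_freq (j k : ℕ) : freq j - freq k = ((j - k : ℤ) : ℝ) * Real.pi := by
  unfold freq; push_cast; ring

theorem freq_add_freq (j k : ℕ) : freq j + freq k = ((j + k + 1 : ℤ) : ℝ) * Real.pi := by
  unfold freq; push_cast; ring

theorem integral_cos_freq_sub (j k m : ℕ) :
    ∫ t in (0 : ℝ)..m, Real.cos (freq j * t - freq k * t) = if j = k then (m : ℝ) else 0 := by
  simp only [← sub_mul, freq_sub_freq, integral_cos_int_mul_pi, sub_eq_zero, Nat.cast_inj]

theorem integral_cos_freq_add (j k m : ℕ) :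
    ∫ t in (0 : ℝ)..m, Real.cos (freq j * t + freq k * t) = 0 := by
  simp only [← add_mul, freq_add_freq, integral_cos_int_mul_pi]
  exact if_neg (by omega)

theorem integral_cos_freq_mul_cos_freq (j k m : ℕ) :
    ∫ t in (0 : ℝ)..m, Real.cos (freq j * t) * Real.cos (freq k * t)
      = if j = k then (m / 2 : ℝ) else 0 := by
  have hprod : ∀ t, Real.cos (freq j * t) * Real.cos (freq k * t)
      = (1 / 2) * (Real.cos (freq j * t - freq k * t) + Real.cos (freq j * t + freq k * t)) :=
    fun t => by rw [Real.cos_sub, Real.cos_add]; ring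
  simp only [hprod]
  rw [intervalIntegral.integral_const_mul, intervalIntegral.integral_add
    (Continuous.intervalIntegrable (by fun_prop) _ _)
    (Continuous.intervalIntegrable (by fun_prop) _ _),
    integral_cos_freq_sub, integral_cos_freq_add]
  split_ifs <;> ring

theorem integral_sin_freq_mul_sin_freq (j k m : ℕ) :
    ∫ t in (0 : ℝ)..m, Real.sin (freq j * t) * Real.sin (freq k * t)
      = if j = k then (m / 2 : ℝ) else 0 := by
  have hprod : ∀ t, Real.sin (freq j * t) * Real.sin (freq k * t)
      = (1 / 2) * (Real.cos (freq j * t - freq k * t) - Real.cos (freq j * t + freq k * t)) :=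
    fun t => by rw [Real.cos_sub, Real.cos_add]; ring
  simp only [hprod]
  rw [intervalIntegral.integral_const_mul, intervalIntegral.integral_sub
    (Continuous.intervalIntegrable (by fun_prop) _ _)
    (Continuous.intervalIntegrable (by fun_prop) _ _),
    integral_cos_freq_sub, integral_cos_freq_add]
  split_ifs <;> ring

theorem integral_cos_freq_mul_sin_freq (j k m : ℕ) :
    ∫ t in (0 : ℝ)..(2 * m : ℕ), Real.cos (freq j * t) * Real.sin (freq k * t) = 0 := by
  have hprod : ∀ t, Real.cos (freq j * t) * Real.sin (freq k * t)
      = (1 / 2) * (Real.sin ((freq j + freq k) * t) - Real.sin ((freq j - freq k) * t)) :=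
    fun t => by rw [add_mul, sub_mul, Real.sin_sub, Real.sin_add]; ring
  simp only [hprod]
  rw [intervalIntegral.integral_const_mul, intervalIntegral.integral_sub
    (Continuous.intervalIntegrable (by fun_prop) _ _)
    (Continuous.intervalIntegrable (by fun_prop) _ _), freq_add_freq, freq_sub_freq,
    integral_sin_int_mul_pi, integral_sin_int_mul_pi, sub_self, mul_zero]

/-- The eigenfunctions `√2 sin ((k + 1/2) π x)` of `-∂ₓₓ`, normalized in `L²(Ω)`. -/
def mode (k : ℕ) (x : ℝ) : ℝ := √2 * Real.sin (freq k * x)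

/-- The functions `√2 cos ((k + 1/2) π x)`, i.e. the derivatives of the eigenfunctions
normalized in `L²(Ω)`. -/
def comode (k : ℕ) (x : ℝ) : ℝ := √2 * Real.cos (freq k * x)

@[fun_prop]
theorem continuous_mode (k : ℕ) : Continuous (mode k) := by unfold mode; fun_prop

@[fun_prop]
theorem continuous_comode (k : ℕ) : Continuous (comode k) := by unfold comode; fun_prop

theorem abs_mode_le (k : ℕ) (x : ℝ) : |mode k x| ≤ √2 := by
  rw [mode, abs_mul, abs_of_nonneg (Real.sqrt_nonneg 2)]
  exact mul_le_of_le_one_right (Real.sqrt_nonneg 2) (Real.abs_sin_le_one _)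

theorem sq_mode_le (k : ℕ) (x : ℝ) : mode k x ^ 2 ≤ 2 := by
  rw [← sq_abs]
  exact (pow_le_pow_left₀ (abs_nonneg _) (abs_mode_le k x) 2).trans_eq (Real.sq_sqrt two_pos.le)

theorem hasDerivAt_mode (k : ℕ) (x : ℝ) : HasDerivAt (mode k) (freq k * comode k x) x := by
  refine ((((hasDerivAt_id x).const_mul (freq k)).sin).const_mul (√2)).congr_deriv ?_
  simp only [id, comode]; ring

theorem hasDerivAt_comode (k : ℕ) (x : ℝ) : HasDerivAt (comode k) (-(freq k * mode k x)) x := by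
  refine ((((hasDerivAt_id x).const_mul (freq k)).cos).const_mul (√2)).congr_deriv ?_
  simp only [id, mode]; ring

theorem memLp_mode (k : ℕ) : MemLp (mode k) 2 muOmega :=
  memLp_restrict_Ioo_of_continuousOn (continuous_mode k).continuousOn

theorem memLp_comode (k : ℕ) : MemLp (comode k) 2 muOmega :=
  memLp_restrict_Ioo_of_continuousOn (continuous_comode k).continuousOn

/-- The eigenfunctions as elements of `L²(Ω)`. -/
def modeL2 (k : ℕ) : L2Omega := (memLp_mode k).toLp

/-- The normalized derivatives of the eigenfunctions as elements of `L²(Ω)`. -/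
def comodeL2 (k : ℕ) : L2Omega := (memLp_comode k).toLp

theorem modeL2_ae_eq (k : ℕ) : modeL2 k =ᵐ[muOmega] mode k := (memLp_mode k).coeFn_toLp

theorem comodeL2_ae_eq (k : ℕ) : comodeL2 k =ᵐ[muOmega] comode k := (memLp_comode k).coeFn_toLp

theorem inner_modeL2 (k : ℕ) (v : L2Omega) :
    inner ℝ (modeL2 k) v = ∫ x in Ioo (0 : ℝ) 1, mode k x * v x :=
  inner_eq_integral_of_ae_eq (modeL2_ae_eq k) .rfl

theorem inner_comodeL2 (k : ℕ) (v : L2Omega) :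
    inner ℝ (comodeL2 k) v = ∫ x in Ioo (0 : ℝ) 1, comode k x * v x :=
  inner_eq_integral_of_ae_eq (comodeL2_ae_eq k) .rfl

theorem integral_sqrt_two_mul_mul (f g : ℝ → ℝ) :
    ∫ x in Ioo (0 : ℝ) 1, (√2 * f x) * (√2 * g x) = 2 * ∫ x in (0 : ℝ)..1, f x * g x := by
  rw [intervalIntegral_eq_integral_Ioo zero_le_one, ← integral_const_mul]
  congr 1; ext x
  rw [mul_mul_mul_comm, Real.mul_self_sqrt zero_le_two]

theorem orthonormal_modeL2 : Orthonormal ℝ modeL2 := by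
  rw [orthonormal_iff_ite]
  intro j k
  have hsin := integral_sin_freq_mul_sin_freq j k 1
  rw [Nat.cast_one] at hsin
  simp only [inner_eq_integral_of_ae_eq (modeL2_ae_eq j) (modeL2_ae_eq k), mode,
    integral_sqrt_two_mul_mul, hsin]
  split_ifs <;> norm_num

theorem orthonormal_comodeL2 : Orthonormal ℝ comodeL2 := by
  rw [orthonormal_iff_ite]
  intro j k
  have hcos := integral_cos_freq_mul_cos_freq j k 1
  rw [Nat.cast_one] at hcos
  simp only [inner_eq_integral_of_ae_eq (comodeL2_ae_eq j) (comodeL2_ae_eq k), comode,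
    integral_sqrt_two_mul_mul, hcos]
  split_ifs <;> norm_num

theorem integral_mul_cos_pow_mul_sin_eq_zero {f : ℝ → ℝ} (hf : Integrable f muOmega)
    (h : ∀ k : ℕ, ∫ x in Ioo (0 : ℝ) 1, f x * Real.sin (freq k * x) = 0) (n : ℕ) (k : ℤ) :
    ∫ x in Ioo (0 : ℝ) 1,
      f x * (Real.cos (Real.pi * x) ^ n * Real.sin ((k + 1 / 2) * Real.pi * x)) = 0 := by
  induction n generalizing k with
  | zero =>
    simp only [pow_zero, one_mul]
    rcases le_or_gt 0 k with hk | hk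
    · lift k to ℕ using hk
      simpa [freq] using h k
    · obtain ⟨j, rfl⟩ : ∃ j : ℕ, k = -(j + 1 : ℤ) := ⟨(-k - 1).toNat, by omega⟩
      have hodd : ∀ x : ℝ, Real.sin ((((-(j + 1 : ℤ) : ℤ) : ℝ) + 1 / 2) * Real.pi * x)
          = -Real.sin (freq j * x) := fun x => by
        rw [← Real.sin_neg]
        congr 1
        unfold freq; push_cast; ring
      simp only [hodd, mul_neg, integral_neg, h j, neg_zero]
  | succ n ih =>
    have hintegrable : ∀ j : ℤ, Integrable (fun x =>
        f x * (Real.cos (Real.pi * x) ^ n * Real.sin ((j + 1 / 2) * Real.pi * x))) muOmega := by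
      refine fun j => hf.mul_bdd (c := 1) (by fun_prop) (Eventually.of_forall fun x => ?_)
      rw [norm_mul, norm_pow]
      exact mul_le_one₀ (pow_le_one₀ (norm_nonneg _) (Real.abs_cos_le_one _)) (norm_nonneg _)
        (Real.abs_sin_le_one _)
    have hshift : ∀ x, f x * (Real.cos (Real.pi * x) ^ (n + 1)
          * Real.sin ((k + 1 / 2) * Real.pi * x))
        = (1 / 2) * (f x * (Real.cos (Real.pi * x) ^ n *
            Real.sin (((k + 1 : ℤ) + 1 / 2) * Real.pi * x))
          + f x * (Real.cos (Real.pi * x) ^ n *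
            Real.sin (((k - 1 : ℤ) + 1 / 2) * Real.pi * x))) := by
      intro x
      have hsucc : (((k + 1 : ℤ) : ℝ) + 1 / 2) * Real.pi * x
          = (k + 1 / 2) * Real.pi * x + Real.pi * x := by push_cast; ring
      have hpred : (((k - 1 : ℤ) : ℝ) + 1 / 2) * Real.pi * x
          = (k + 1 / 2) * Real.pi * x - Real.pi * x := by push_cast; ring
      rw [hsucc, hpred, Real.sin_add, Real.sin_sub]
      ring
    simp only [hshift]
    rw [integral_const_mul, integral_add (hintegrable _) (hintegrable _), ih, ih, add_zero,
      mul_zero]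

theorem integral_continuous_mul_sin_mul_eq_zero {f : ℝ → ℝ} (hf : Integrable f muOmega)
    (h : ∀ k : ℕ, ∫ x in Ioo (0 : ℝ) 1, f x * Real.sin (freq k * x) = 0) {q : ℝ → ℝ}
    (hq : Continuous q) :
    ∫ x in Ioo (0 : ℝ) 1, q x * (Real.sin (Real.pi / 2 * x) * f x) = 0 := by
  have hF : Integrable (fun x => Real.sin (Real.pi / 2 * x) * f x) muOmega :=
    hf.bdd_mul (c := 1) (by fun_prop) (Eventually.of_forall fun x => Real.abs_sin_le_one _)
  have hmoments : ∀ n : ℕ, ∫ x in Ioo (0 : ℝ) 1,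
      Real.sin (Real.pi / 2 * x) * f x * Real.cos (Real.pi * x) ^ n = 0 := fun n => by
    refine Eq.trans ?_ (integral_mul_cos_pow_mul_sin_eq_zero hf h n 0)
    congr 1; ext x
    rw [Int.cast_zero, zero_add, one_div_mul_eq_div]
    ring
  -- `q` is a continuous function of `cos (π x)`, so Weierstrass' theorem applies.
  refine Eq.trans (setIntegral_congr_fun measurableSet_Ioo fun x hx => ?_)
    (integral_mul_comp_eq_zero_of_moments hF (by fun_prop)
      (Eventually.of_forall fun x => ⟨Real.neg_one_le_cos _, Real.cos_le_one _⟩) hmoments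
      (hq.comp (Real.continuous_arccos.div_const Real.pi)))
  have harccos : Real.arccos (Real.cos (Real.pi * x)) / Real.pi = x := by
    rw [Real.arccos_cos (mul_nonneg Real.pi_pos.le hx.1.le)
      (mul_le_of_le_one_right Real.pi_pos.le hx.2.le), mul_div_cancel_left₀ _ Real.pi_ne_zero]
  rw [Function.comp_apply, harccos, mul_comm]

theorem ae_eq_zero_of_integral_mul_sin_freq_eq_zero {f : ℝ → ℝ} (hf : Integrable f muOmega)
    (h : ∀ k : ℕ, ∫ x in Ioo (0 : ℝ) 1, f x * Real.sin (freq k * x) = 0) :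
    f =ᵐ[muOmega] 0 := by
  have hF : Integrable (fun x => Real.sin (Real.pi / 2 * x) * f x) muOmega :=
    hf.bdd_mul (c := 1) (by fun_prop) (Eventually.of_forall fun x => Real.abs_sin_le_one _)
  have hzero : (fun x => Real.sin (Real.pi / 2 * x) * f x) =ᵐ[muOmega] 0 :=
    ae_eq_of_integral_continuous_mul_eq hF (integrable_zero _ _ _) fun q hq => by
      simp only [integral_continuous_mul_sin_mul_eq_zero hf h hq, Pi.zero_apply, mul_zero,
        integral_zero]
  filter_upwards [hzero, ae_restrict_mem measurableSet_Ioo] with x hx hmem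
  refine (mul_eq_zero.1 hx).resolve_left (Real.sin_pos_of_pos_of_lt_pi ?_ ?_).ne'
  · exact mul_pos Real.pi_div_two_pos hmem.1
  · nlinarith [Real.pi_pos, hmem.2]

theorem orthogonal_span_modeL2 : (Submodule.span ℝ (Set.range modeL2))ᗮ = ⊥ := by
  refine (Submodule.eq_bot_iff _).2 fun f hf => ?_
  refine Lp.eq_zero_iff_ae_eq_zero.2
    (ae_eq_zero_of_integral_mul_sin_freq_eq_zero (integrable_L2Omega f) fun k => ?_)
  have horth := (Submodule.mem_orthogonal _ _).1 hf (modeL2 k)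
    (Submodule.subset_span (mem_range_self k))
  simp only [inner_modeL2, mode, mul_assoc, integral_const_mul] at horth
  simpa only [mul_comm] using (mul_eq_zero.1 horth).resolve_left (by positivity)

/-- The Hilbert basis of `L²(Ω)` formed by the eigenfunctions. -/
def modeBasis : HilbertBasis ℕ ℝ L2Omega :=
  HilbertBasis.mkOfOrthogonalEqBot orthonormal_modeL2 orthogonal_span_modeL2

theorem modeBasis_apply (k : ℕ) : modeBasis k = modeL2 k := by
  rw [modeBasis, HilbertBasis.coe_mkOfOrthogonalEqBot]

theorem modeL2_mem_h1ZeroGraph (k : ℕ) :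
    ((modeL2 k, freq k • comodeL2 k) : L2Omega × L2Omega) ∈ h1ZeroGraph := by
  refine mem_h1ZeroGraph_of_ae_eq_integral ?_
  have hdx : (freq k • comodeL2 k : L2Omega) =ᵐ[muOmega] fun s => freq k * comode k s := by
    filter_upwards [Lp.coeFn_smul (freq k) (comodeL2 k), comodeL2_ae_eq k] with s hsmul hs
    rw [hsmul, Pi.smul_apply, hs, smul_eq_mul]
  filter_upwards [modeL2_ae_eq k, ae_restrict_mem measurableSet_Ioo] with x hmode hx
  calc modeL2 k x = mode k x - mode k 0 := by simp [hmode, mode]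
    _ = ∫ s in (0 : ℝ)..x, freq k * comode k s :=
        (intervalIntegral.integral_eq_sub_of_hasDerivAt (fun s _ => hasDerivAt_mode k s)
          (Continuous.intervalIntegrable (by fun_prop) _ _)).symm
    _ = ∫ s in (0 : ℝ)..x, (freq k • comodeL2 k : L2Omega) s := by
        simp only [intervalIntegral_eq_integral_Ioo hx.1.le]
        exact integral_congr_ae (ae_restrict_of_ae_restrict_of_subset
          (Ioo_subset_Ioo_right hx.2.le) hdx.symm)

/-- The eigenfunctions as elements of `H¹₍₀₎(Ω)`. -/
def modeH1 (k : ℕ) : H1Zero := ⟨(modeL2 k, freq k • comodeL2 k), modeL2_mem_h1ZeroGraph k⟩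

theorem modeH1_toL2 (k : ℕ) : (modeH1 k).toL2 = modeL2 k := rfl

theorem modeH1_dx (k : ℕ) : (modeH1 k).dx = freq k • comodeL2 k := rfl

theorem H1Zero.norm_eq_norm_dx (z : H1Zero) : ‖z‖ = ‖z.dx‖ := rfl

theorem inner_modeH1_dx (k : ℕ) (z : H1Zero) :
    inner ℝ (modeH1 k).dx z.dx = freq k ^ 2 * inner ℝ (modeL2 k) z.toL2 := by
  rw [modeH1_dx, real_inner_smul_left, inner_comodeL2, inner_modeL2,
    z.integral_mul_dx (P := comode k) (p := fun x => freq k * mode k x) (by fun_prop)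
      (hasDerivAt_comode k) (by simp [comode, cos_freq])]
  simp only [mul_assoc, integral_const_mul]
  ring

theorem sum_sq_modeH1_div_freq_le (φ₁ : HNegOne) (s : Finset ℕ) :
    ∑ k ∈ s, (φ₁ (modeH1 k) / freq k) ^ 2 ≤ ‖φ₁‖ ^ 2 := by
  have hdx : ∀ a : ℕ → ℝ, H1Zero.dx (∑ k ∈ s, a k • (freq k)⁻¹ • modeH1 k)
      = ∑ k ∈ s, a k • comodeL2 k := fun a => by
    simp only [map_sum, map_smul, modeH1_dx, inv_smul_smul₀ (freq_ne_zero _)]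
  have hbessel := sum_sq_apply_le_norm_sq (e := fun k => (freq k)⁻¹ • modeH1 k) (s := s)
    (fun a => by
      rw [H1Zero.norm_eq_norm_dx, hdx, ← real_inner_self_eq_norm_sq,
        orthonormal_comodeL2.inner_sum]
      exact (Finset.sum_congr rfl fun k _ => by simp [sq]).le) φ₁
  simpa only [map_smul, smul_eq_mul, inv_mul_eq_div] using hbessel

/-! ### Coefficients and test functions -/

/-- Lebesgue measure on `(0,T)`. -/
abbrev muTime (T : ℝ) : Measure ℝ := volume.restrict (Ioo (0 : ℝ) T)

theorem restrict_cyl (T : ℝ) : volume.restrict (cyl T) = muOmega.prod (muTime T) := by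
  rw [Measure.prod_restrict, Measure.volume_eq_prod]

theorem ae_ae_of_ae_cyl {T : ℝ} {p : ℝ × ℝ → Prop} (h : ∀ᵐ z ∂volume.restrict (cyl T), p z) :
    ∀ᵐ t ∂muTime T, ∀ᵐ x ∂muOmega, p (x, t) :=
  ae_ae_of_ae_prod_swap (restrict_cyl T ▸ h)

instance (T : ℝ) : IsFiniteMeasure (volume.restrict (cyl T)) := by
  rw [restrict_cyl]; infer_instance

/-- The coefficient of `f(·,t)` along the `k`-th eigenfunction, as a function of `t`. -/
def coeff (f : ℝ × ℝ → ℝ) (k : ℕ) (t : ℝ) : ℝ := ∫ x in Ioo (0 : ℝ) 1, mode k x * f (x, t)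

section Coeff

variable {f : ℝ × ℝ → ℝ} {t T : ℝ}

theorem coeff_eq_inner (hf : MemLp (fun x => f (x, t)) 2 muOmega) (k : ℕ) :
    coeff f k t = inner ℝ (modeL2 k) hf.toLp :=
  (inner_eq_integral_of_ae_eq (modeL2_ae_eq k) hf.coeFn_toLp).symm

theorem sum_coeff_sq_le (hf : MemLp (fun x => f (x, t)) 2 muOmega) (s : Finset ℕ) :
    ∑ k ∈ s, coeff f k t ^ 2 ≤ ∫ x in Ioo (0 : ℝ) 1, f (x, t) ^ 2 := by
  simpa only [← coeff_eq_inner hf, Real.norm_eq_abs, sq_abs,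
    norm_sq_eq_integral_of_ae_eq hf.coeFn_toLp]
    using orthonormal_modeL2.sum_inner_products_le (x := hf.toLp) (s := s)

theorem hasSum_coeff_sq (hf : MemLp (fun x => f (x, t)) 2 muOmega) :
    HasSum (fun k => coeff f k t ^ 2) (∫ x in Ioo (0 : ℝ) 1, f (x, t) ^ 2) := by
  have hparseval := modeBasis.hasSum_inner_mul_inner hf.toLp hf.toLp
  rw [real_inner_self_eq_norm_sq, norm_sq_eq_integral_of_ae_eq hf.coeFn_toLp] at hparseval
  refine hparseval.congr_fun fun k => ?_
  rw [coeff_eq_inner hf, modeBasis_apply, real_inner_comm, sq]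

theorem integrable_mode_mul (hf : Integrable f (volume.restrict (cyl T))) (k : ℕ) :
    Integrable (fun p => mode k p.1 * f p) (volume.restrict (cyl T)) :=
  hf.bdd_mul (c := √2) (by fun_prop) (.of_forall fun p => abs_mode_le k p.1)

theorem memLp_coeff (hf : MemLp f 2 (volume.restrict (cyl T))) (k : ℕ) :
    MemLp (coeff f k) 2 (muTime T) := by
  have hmode := integrable_mode_mul (hf.integrable one_le_two) k
  rw [restrict_cyl] at hf hmode
  have hmeas : AEStronglyMeasurable (coeff f k) (muTime T) :=
    hmode.integral_prod_right.aestronglyMeasurable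
  rw [memLp_two_iff_integrable_sq hmeas]
  refine hf.integrable_sq.integral_prod_right.mono' (hmeas.pow 2) ?_
  filter_upwards [memLp_two_section hf] with t ht
  rw [Real.norm_eq_abs, abs_of_nonneg (sq_nonneg _)]
  simpa only [Finset.sum_singleton] using sum_coeff_sq_le ht {k}

theorem exists_bound_of_continuous_time {q : ℝ → ℝ} (hq : Continuous q) (T : ℝ) :
    ∃ C, ∀ᵐ p ∂volume.restrict (cyl T), ‖q p.2‖ ≤ C := by
  obtain ⟨C, hC⟩ := (isCompact_Icc (a := (0 : ℝ)) (b := T)).exists_bound_of_continuousOn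
    hq.continuousOn
  refine ⟨C, ?_⟩
  filter_upwards [ae_restrict_mem (measurableSet_Ioo.prod measurableSet_Ioo)] with p hp
  exact hC p.2 (Ioo_subset_Icc_self hp.2)

theorem memLp_time_mul (hf : MemLp f 2 (volume.restrict (cyl T))) {q : ℝ → ℝ}
    (hq : Continuous q) : MemLp (fun p => q p.2 * f p) 2 (volume.restrict (cyl T)) := by
  obtain ⟨C, hC⟩ := exists_bound_of_continuous_time hq T
  exact hf.mul' (memLp_top_of_bound (by fun_prop) C hC)

theorem coeff_time_mul (q : ℝ → ℝ) (f : ℝ × ℝ → ℝ) (k : ℕ) (t : ℝ) :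
    coeff (fun p => q p.2 * f p) k t = q t * coeff f k t := by
  simp only [coeff, mul_left_comm (mode k _), integral_const_mul]

theorem integrable_mul_mode_mul (hf : Integrable f (volume.restrict (cyl T))) {q : ℝ → ℝ}
    (hq : Continuous q) (k : ℕ) :
    Integrable (fun p => q p.2 * (mode k p.1 * f p)) (volume.restrict (cyl T)) := by
  obtain ⟨C, hC⟩ := exists_bound_of_continuous_time hq T
  exact (integrable_mode_mul hf k).bdd_mul (by fun_prop) hC

theorem integral_mul_mode_mul (hf : Integrable f (volume.restrict (cyl T))) {q : ℝ → ℝ}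
    (hq : Continuous q) (k : ℕ) :
    ∫ p in cyl T, q p.2 * (mode k p.1 * f p) = ∫ t in Ioo 0 T, q t * coeff f k t := by
  have hintegrable := integrable_mul_mode_mul hf hq k
  rw [restrict_cyl] at hintegrable ⊢
  rw [integral_prod_symm _ hintegrable]
  simp only [coeff, integral_const_mul]

end Coeff

theorem LinfCyl.ae_abs_le {T : ℝ} (A : LinfCyl T) :
    ∀ᵐ p ∂volume.restrict (cyl T), |A p| ≤ ‖A‖ := by
  have hfin : eLpNormEssSup A (volume.restrict (cyl T)) ≠ ⊤ := by
    simpa only [eLpNorm_exponent_top] using (Lp.memLp A).2.ne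
  filter_upwards [ae_le_eLpNormEssSup (f := A) (μ := volume.restrict (cyl T))] with p hp
  rw [Lp.norm_def, eLpNorm_exponent_top, ← Real.norm_eq_abs, ← toReal_enorm]
  exact ENNReal.toReal_mono hfin hp

theorem LinfCyl.ae_aestronglyMeasurable_section {T : ℝ} (A : LinfCyl T) :
    ∀ᵐ t ∂muTime T, AEStronglyMeasurable (fun x => A (x, t)) muOmega :=
  AEStronglyMeasurable.prodMk_right (restrict_cyl T ▸ (Lp.memLp A).aestronglyMeasurable)

/-- The functional `z ↦ ∫ eₖ z` on `H¹₍₀₎(Ω)`, where `eₖ` is the `k`-th eigenfunction. -/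
def modeDual (k : ℕ) : HNegOne :=
  ((innerSL ℝ (modeL2 k)).toLinearMap.comp H1Zero.toL2).mkContinuous (freq k)⁻¹ fun z => by
    have hdx : freq k ^ 2 * |inner ℝ (modeL2 k) z.toL2| ≤ freq k * ‖z‖ := by
      have hcs := abs_real_inner_le_norm (modeH1 k).dx z.dx
      rwa [inner_modeH1_dx, modeH1_dx, norm_smul, orthonormal_comodeL2.1, abs_mul, mul_one,
        Real.norm_eq_abs, abs_of_pos (freq_pos k), abs_of_pos (pow_pos (freq_pos k) 2),
        ← H1Zero.norm_eq_norm_dx] at hcs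
    rw [inv_mul_eq_div, le_div_iff₀' (freq_pos k)]
    refine le_of_mul_le_mul_left ?_ (freq_pos k)
    rwa [← mul_assoc, ← sq]

theorem modeDual_apply (k : ℕ) (z : H1Zero) : modeDual k z = inner ℝ (modeL2 k) z.toL2 := rfl

section TestFunction

variable {T : ℝ} (A : LinfCyl T)

theorem memLp_source {q θ : ℝ → ℝ} (hq : Continuous q) (hθ : Continuous θ) (k : ℕ) :
    MemLp (fun p : ℝ × ℝ => q p.2 * mode k p.1 + A p * (θ p.2 * mode k p.1)) 2
      (volume.restrict (cyl T)) := by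
  have hmode : MemLp (fun p : ℝ × ℝ => mode k p.1) 2 (volume.restrict (cyl T)) :=
    MemLp.of_bound (by fun_prop) √2 (.of_forall fun p => abs_mode_le k p.1)
  exact (memLp_time_mul hmode hq).add ((memLp_time_mul hmode hθ).mul' (Lp.memLp A))

theorem integral_source_mul {a g : ℝ → ℝ} {b q θ : ℝ} {k : ℕ}
    (ha : AEStronglyMeasurable a muOmega) (hab : ∀ᵐ x ∂muOmega, |a x| ≤ b)
    (hg : g =ᵐ[muOmega] fun x => q * mode k x + a x * (θ * mode k x)) (z : L2Omega) :
    ∫ x in Ioo (0 : ℝ) 1, g x * z x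
      = q * inner ℝ (modeL2 k) z
        + ∫ x in Ioo (0 : ℝ) 1, a x * (θ • modeL2 k : L2Omega) x * z x := by
  have hmode : Integrable (fun x => mode k x * z x) muOmega :=
    (integrable_L2Omega z).bdd_mul (c := √2) (by fun_prop) (.of_forall fun x => abs_mode_le k x)
  have hpot : Integrable (fun x => θ * (a x * (mode k x * z x))) muOmega :=
    (hmode.bdd_mul ha hab).const_mul θ
  have hsmul : (θ • modeL2 k : L2Omega) =ᵐ[muOmega] fun x => θ * mode k x := by
    filter_upwards [modeL2_ae_eq k, Lp.coeFn_smul θ (modeL2 k)] with x hx hxsmul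
    rw [hxsmul, Pi.smul_apply, hx, smul_eq_mul]
  calc ∫ x in Ioo (0 : ℝ) 1, g x * z x
      = ∫ x in Ioo (0 : ℝ) 1, (q * (mode k x * z x) + θ * (a x * (mode k x * z x))) := by
        refine integral_congr_ae (hg.mono fun x hx => ?_)
        simp only [hx]; ring
    _ = q * inner ℝ (modeL2 k) z + ∫ x in Ioo (0 : ℝ) 1, θ * (a x * (mode k x * z x)) := by
        rw [integral_add (hmode.const_mul q) hpot, integral_const_mul, inner_modeL2]
    _ = _ := by
        congr 1
        refine integral_congr_ae (hsmul.mono fun x hx => ?_)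
        simp only [hx]; ring

theorem inner_deriv_eq_add_integral {c θ' : ℝ → ℝ} (hc : Continuous c)
    (hθ' : ∀ t, HasDerivAt θ' (c t) t) (k : ℕ) (t : ℝ) (z : H1Zero) :
    inner ℝ (θ' t • modeL2 k) z.toL2
      = inner ℝ (θ' 0 • modeL2 k) z.toL2 + (∫ s in (0 : ℝ)..t, c s • modeDual k) z := by
  rw [intervalIntegral.integral_smul_const, intervalIntegral.integral_eq_sub_of_hasDerivAt
    (fun s _ => hθ' s) (hc.intervalIntegrable _ _), real_inner_smul_left, real_inner_smul_left,
    smul_apply, smul_eq_mul, modeDual_apply]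
  ring

theorem isBackwardWeakSolution_mode {q θ θ' : ℝ → ℝ} (k : ℕ) (hq : Continuous q)
    (hθc : Continuous θ) (hθ : ∀ t, HasDerivAt θ (θ' t) t)
    (hθ' : ∀ t, HasDerivAt θ' (q t - freq k ^ 2 * θ t) t) (hθT : θ T = 0) (hθ'T : θ' T = 0) :
    IsBackwardWeakSolution T A (memLp_source A hq hθc k).toLp
      (fun t => θ t • modeH1 k) (fun t => θ' t • modeL2 k) where
  continuousOn := (hθc.smul continuous_const).continuousOn
  hasDeriv t _ := by
    simp only [map_smul, modeH1_toL2]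
    exact ((hθ t).smul_const _).hasDerivWithinAt
  continuousOn_deriv := by
    have hθ'c : Continuous θ' := continuous_iff_continuousAt.2 fun t => (hθ' t).continuousAt
    exact (hθ'c.smul continuous_const).continuousOn
  equation := by
    have hc : Continuous fun t => q t - freq k ^ 2 * θ t := by fun_prop
    refine ⟨fun t => (q t - freq k ^ 2 * θ t) • modeDual k,
      memLp_restrict_Ioo_of_continuousOn (hc.smul continuous_const).continuousOn, ?_, ?_⟩
    · intro t _ z
      rw [← inner_eq_integral_of_ae_eq .rfl .rfl, ← inner_eq_integral_of_ae_eq .rfl .rfl]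
      exact inner_deriv_eq_add_integral hc hθ' k t z
    · filter_upwards [ae_ae_of_ae_cyl (memLp_source A hq hθc k).coeFn_toLp,
        ae_ae_of_ae_cyl A.ae_abs_le, A.ae_aestronglyMeasurable_section]
        with t ht_source ht_bound ht_meas z
      rw [← inner_eq_integral_of_ae_eq .rfl .rfl,
        integral_source_mul ht_meas ht_bound ht_source z.toL2]
      simp only [map_smul, modeH1_toL2, real_inner_smul_left, inner_modeH1_dx, smul_apply,
        modeDual_apply, smul_eq_mul]
      ring
  final := by simp [hθT]
  final_deriv := by simp [hθ'T]

end TestFunction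

/-! ### The oscillator equation -/

/-- The solution of `θ'' + ω² θ = q` with zero data at time `T`. -/
def backwardDuhamel (ω T : ℝ) (q : ℝ → ℝ) (t : ℝ) : ℝ :=
  ∫ s in t..T, Real.sin (ω * (s - t)) / ω * q s

/-- The time derivative of `backwardDuhamel`. -/
def backwardDuhamelDeriv (ω T : ℝ) (q : ℝ → ℝ) (t : ℝ) : ℝ :=
  -∫ s in t..T, Real.cos (ω * (s - t)) * q s

/-- The solution of `u'' + ω² u = v` with zero data at time `0`. -/
def duhamel (ω : ℝ) (v : ℝ → ℝ) (t : ℝ) : ℝ :=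
  ∫ s in (0 : ℝ)..t, Real.sin (ω * (t - s)) / ω * v s

section Duhamel

variable {ω T : ℝ} {q v : ℝ → ℝ}

theorem backwardDuhamel_eq (hq : Continuous q) (t : ℝ) :
    backwardDuhamel ω T q t = (Real.cos (ω * t) * (∫ s in t..T, Real.sin (ω * s) * q s)
      - Real.sin (ω * t) * ∫ s in t..T, Real.cos (ω * s) * q s) / ω := by
  rw [← intervalIntegral.integral_const_mul, ← intervalIntegral.integral_const_mul,
    ← intervalIntegral.integral_sub (Continuous.intervalIntegrable (by fun_prop) _ _)
      (Continuous.intervalIntegrable (by fun_prop) _ _), ← intervalIntegral.integral_div]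
  refine intervalIntegral.integral_congr fun s _ => ?_
  rw [mul_sub, Real.sin_sub]
  ring

theorem backwardDuhamelDeriv_eq (hq : Continuous q) (t : ℝ) :
    backwardDuhamelDeriv ω T q t = -(Real.sin (ω * t) * (∫ s in t..T, Real.sin (ω * s) * q s)
      + Real.cos (ω * t) * ∫ s in t..T, Real.cos (ω * s) * q s) := by
  rw [← intervalIntegral.integral_const_mul, ← intervalIntegral.integral_const_mul,
    ← intervalIntegral.integral_add (Continuous.intervalIntegrable (by fun_prop) _ _)
      (Continuous.intervalIntegrable (by fun_prop) _ _), backwardDuhamelDeriv]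
  congr 1
  refine intervalIntegral.integral_congr fun s _ => ?_
  rw [mul_sub, Real.cos_sub]
  ring

theorem hasDerivAt_integral_left {f : ℝ → ℝ} (hf : Continuous f) (T t : ℝ) :
    HasDerivAt (fun t => ∫ s in t..T, f s) (-f t) t :=
  intervalIntegral.integral_hasDerivAt_left (hf.intervalIntegrable _ _)
    (hf.stronglyMeasurableAtFilter _ _) hf.continuousAt

theorem hasDerivAt_sin_mul (ω t : ℝ) :
    HasDerivAt (fun t => Real.sin (ω * t)) (Real.cos (ω * t) * ω) t := by
  simpa using ((hasDerivAt_id t).const_mul ω).sin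

theorem hasDerivAt_cos_mul (ω t : ℝ) :
    HasDerivAt (fun t => Real.cos (ω * t)) (-Real.sin (ω * t) * ω) t := by
  simpa using ((hasDerivAt_id t).const_mul ω).cos

theorem hasDerivAt_backwardDuhamel (hω : ω ≠ 0) (hq : Continuous q) (t : ℝ) :
    HasDerivAt (backwardDuhamel ω T q) (backwardDuhamelDeriv ω T q t) t := by
  rw [funext (backwardDuhamel_eq hq), backwardDuhamelDeriv_eq hq]
  have hsin := hasDerivAt_integral_left (f := fun s => Real.sin (ω * s) * q s) (by fun_prop) T t
  have hcos := hasDerivAt_integral_left (f := fun s => Real.cos (ω * s) * q s) (by fun_prop) T t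
  refine ((((hasDerivAt_cos_mul ω t).mul hsin).sub
    ((hasDerivAt_sin_mul ω t).mul hcos)).div_const ω).congr_deriv ?_
  field_simp
  ring

theorem hasDerivAt_backwardDuhamelDeriv (hq : Continuous q) (t : ℝ) :
    HasDerivAt (backwardDuhamelDeriv ω T q) (q t - ω ^ 2 * backwardDuhamel ω T q t) t := by
  rw [funext (backwardDuhamelDeriv_eq hq), backwardDuhamel_eq hq]
  have hsin := hasDerivAt_integral_left (f := fun s => Real.sin (ω * s) * q s) (by fun_prop) T t
  have hcos := hasDerivAt_integral_left (f := fun s => Real.cos (ω * s) * q s) (by fun_prop) T t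
  refine ((((hasDerivAt_sin_mul ω t).mul hsin).add
    ((hasDerivAt_cos_mul ω t).mul hcos)).neg).congr_deriv ?_
  have hone := Real.sin_sq_add_cos_sq (ω * t)
  field_simp
  linear_combination (q t) * hone

theorem continuous_backwardDuhamel (hω : ω ≠ 0) (hq : Continuous q) :
    Continuous (backwardDuhamel ω T q) :=
  continuous_iff_continuousAt.2 fun t => (hasDerivAt_backwardDuhamel hω hq t).continuousAt

theorem integral_mul_duhamel (hq : Continuous q) (hv : IntegrableOn v (Ioo 0 T)) :
    ∫ t in Ioo 0 T, q t * duhamel ω v t = ∫ t in Ioo 0 T, backwardDuhamel ω T q t * v t := by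
  have hswap := integral_intervalIntegral_swap (integrableOn_prod_continuous_mul_snd
    (c := fun t s => q t * (Real.sin (ω * (t - s)) / ω)) (by fun_prop) hv)
  simp only [duhamel, backwardDuhamel, ← intervalIntegral.integral_const_mul,
    ← intervalIntegral.integral_mul_const]
  simpa only [mul_comm, mul_left_comm] using hswap

theorem continuousOn_duhamel (hv : IntegrableOn v (Ioo 0 T)) :
    ContinuousOn (duhamel ω v) (Icc 0 T) := by
  have hmul : ∀ c : ℝ → ℝ, Continuous c → IntegrableOn (fun s => c s * v s) (Ioo 0 T) :=
    fun c hc => IntegrableOn.continuousOn_mul_of_subset (K := Icc 0 T) hc.continuousOn hv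
      isCompact_Icc measurableSet_Ioo Ioo_subset_Icc_self
  have hcosv := hmul (fun s => Real.cos (ω * s)) (by fun_prop)
  have hsinv := hmul (fun s => Real.sin (ω * s)) (by fun_prop)
  have hsin : ContinuousOn (fun t => Real.sin (ω * t)) (Icc 0 T) := by fun_prop
  have hcos : ContinuousOn (fun t => Real.cos (ω * t)) (Icc 0 T) := by fun_prop
  refine (((hsin.mul (continuousOn_integral_of_integrableOn_Ioo hcosv)).sub
    (hcos.mul (continuousOn_integral_of_integrableOn_Ioo hsinv))).div_const ω).congr fun t ht => ?_
  have h0 : (0 : ℝ) ∈ Icc 0 T := left_mem_Icc.2 (ht.1.trans ht.2)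
  simp only [Pi.sub_apply, Pi.mul_apply]
  rw [← intervalIntegral.integral_const_mul, ← intervalIntegral.integral_const_mul,
    ← intervalIntegral.integral_sub
      ((intervalIntegrable_of_integrableOn_Ioo hcosv h0 ht).const_mul _)
      ((intervalIntegrable_of_integrableOn_Ioo hsinv h0 ht).const_mul _),
    ← intervalIntegral.integral_div]
  refine intervalIntegral.integral_congr fun s _ => ?_
  rw [mul_sub, Real.sin_sub]
  ring

end Duhamel

/-! ### Coefficients of transposition solutions and the energy estimate -/

/-- The coefficient along the `k`-th eigenfunction of the wave with `A = 0` and initial data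
`(φ₀, φ₁)`. -/
def freeCoeff (φ₀ : L2Omega) (φ₁ : HNegOne) (k : ℕ) (t : ℝ) : ℝ :=
  inner ℝ (modeL2 k) φ₀ * Real.cos (freq k * t)
    + φ₁ (modeH1 k) / freq k * Real.sin (freq k * t)

@[fun_prop]
theorem continuous_freeCoeff (φ₀ : L2Omega) (φ₁ : HNegOne) (k : ℕ) :
    Continuous (freeCoeff φ₀ φ₁ k) := by
  unfold freeCoeff; fun_prop

/-- The squared norm of the `k`-th component of the initial data. -/
def dataSq (φ₀ : L2Omega) (φ₁ : HNegOne) (k : ℕ) : ℝ :=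
  inner ℝ (modeL2 k) φ₀ ^ 2 + (φ₁ (modeH1 k) / freq k) ^ 2

theorem dataSq_nonneg (φ₀ : L2Omega) (φ₁ : HNegOne) (k : ℕ) : 0 ≤ dataSq φ₀ φ₁ k := by
  unfold dataSq; positivity

theorem sum_dataSq_le (φ₀ : L2Omega) (φ₁ : HNegOne) (s : Finset ℕ) :
    ∑ k ∈ s, dataSq φ₀ φ₁ k ≤ ‖φ₀‖ ^ 2 + ‖φ₁‖ ^ 2 := by
  simp only [dataSq, Finset.sum_add_distrib]
  refine add_le_add ?_ (sum_sq_modeH1_div_freq_le φ₁ s)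
  simpa only [Real.norm_eq_abs, sq_abs]
    using orthonormal_modeL2.sum_inner_products_le (x := φ₀) (s := s)

theorem freeCoeff_sq_le (φ₀ : L2Omega) (φ₁ : HNegOne) (k : ℕ) (t : ℝ) :
    freeCoeff φ₀ φ₁ k t ^ 2 ≤ dataSq φ₀ φ₁ k := by
  unfold freeCoeff dataSq
  set a := inner ℝ (modeL2 k) φ₀
  set b := φ₁ (modeH1 k) / freq k
  have hone := Real.sin_sq_add_cos_sq (freq k * t)
  nlinarith only [sq_nonneg (a * Real.sin (freq k * t) - b * Real.cos (freq k * t)), hone]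

section Transposition

variable {T : ℝ} {A : LinfCyl T} {φ₀ : L2Omega} {φ₁ : HNegOne} {φ : L2Cyl T}

theorem memLp_potential_mul (A : LinfCyl T) {f : ℝ × ℝ → ℝ}
    (hf : MemLp f 2 (volume.restrict (cyl T))) :
    MemLp (fun p => A p * f p) 2 (volume.restrict (cyl T)) :=
  hf.mul' (Lp.memLp A)

theorem integral_zero_mul (w : ℝ → ℝ → ℝ) :
    ∫ t in Ioo (0 : ℝ) T, ∫ x in Ioo (0 : ℝ) 1, (0 : L2Cyl T) (x, t) * w t x = 0 := by
  refine integral_eq_zero_of_ae ?_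
  filter_upwards [ae_ae_of_ae_cyl (Lp.coeFn_zero ℝ 2 (volume.restrict (cyl T)))] with t ht
  refine integral_eq_zero_of_ae (ht.mono fun x hx => ?_)
  simp only [hx, Pi.zero_apply, zero_mul]

theorem initial_pairing_backwardDuhamel (hT : 0 ≤ T) (φ₀ : L2Omega) (φ₁ : HNegOne) {q : ℝ → ℝ}
    (hq : Continuous q) (k : ℕ) :
    φ₁ (backwardDuhamel (freq k) T q 0 • modeH1 k)
        - inner ℝ φ₀ (backwardDuhamelDeriv (freq k) T q 0 • modeL2 k)
      = ∫ t in Ioo 0 T, q t * freeCoeff φ₀ φ₁ k t := by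
  have hsin : IntervalIntegrable (fun s => Real.sin (freq k * (s - 0)) / freq k * q s) volume 0 T :=
    Continuous.intervalIntegrable (by fun_prop) _ _
  have hcos : IntervalIntegrable (fun s => Real.cos (freq k * (s - 0)) * q s) volume 0 T :=
    Continuous.intervalIntegrable (by fun_prop) _ _
  rw [real_inner_smul_right, map_smul, smul_eq_mul, real_inner_comm, backwardDuhamel,
    backwardDuhamelDeriv, neg_mul, sub_neg_eq_add, ← intervalIntegral.integral_mul_const,
    ← intervalIntegral.integral_mul_const,
    ← intervalIntegral.integral_add (hsin.mul_const _) (hcos.mul_const _),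
    ← intervalIntegral_eq_integral_Ioo hT]
  refine intervalIntegral.integral_congr fun t _ => ?_
  simp only [freeCoeff, sub_zero]
  ring

theorem IsTranspositionSolution.integral_mul_coeff (hT : 0 ≤ T)
    (h : IsTranspositionSolution T A 0 φ₀ φ₁ φ) {q : ℝ → ℝ} (hq : Continuous q) (k : ℕ) :
    (∫ t in Ioo 0 T, q t * coeff φ k t)
        + ∫ t in Ioo 0 T, q t * duhamel (freq k) (coeff (fun p => A p * φ p) k) t
      = ∫ t in Ioo 0 T, q t * freeCoeff φ₀ φ₁ k t := by
  have hφ := (Lp.memLp φ).integrable one_le_two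
  have hpot := memLp_potential_mul A (Lp.memLp φ)
  set θ := backwardDuhamel (freq k) T q
  have hθ : Continuous θ := continuous_backwardDuhamel (freq_ne_zero k) hq
  have hw := isBackwardWeakSolution_mode A k hq hθ
    (hasDerivAt_backwardDuhamel (freq_ne_zero k) hq) (hasDerivAt_backwardDuhamelDeriv hq)
    intervalIntegral.integral_same (neg_eq_zero.2 intervalIntegral.integral_same)
  have hsource : ∫ p in cyl T, φ p * (memLp_source A hq hθ k).toLp _ p
      = (∫ t in Ioo 0 T, q t * coeff φ k t)
        + ∫ t in Ioo 0 T, θ t * coeff (fun p => A p * φ p) k t := by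
    rw [← integral_mul_mode_mul hφ hq k,
      ← integral_mul_mode_mul (hpot.integrable one_le_two) hθ k,
      ← integral_add (integrable_mul_mode_mul hφ hq k)
        (integrable_mul_mode_mul (hpot.integrable one_le_two) hθ k)]
    refine integral_congr_ae ?_
    filter_upwards [(memLp_source A hq hθ k).coeFn_toLp] with p hp
    rw [hp]
    ring
  rw [integral_mul_duhamel hq ((memLp_coeff hpot k).integrable one_le_two), ← hsource,
    h _ _ _ hw, integral_zero_mul fun t => (θ t • modeH1 k).toL2, zero_add,
    ← inner_eq_integral_of_ae_eq .rfl .rfl, initial_pairing_backwardDuhamel hT φ₀ φ₁ hq k]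

theorem IsTranspositionSolution.coeff_ae_eq (hT : 0 ≤ T)
    (h : IsTranspositionSolution T A 0 φ₀ φ₁ φ) (k : ℕ) :
    coeff φ k =ᵐ[muTime T] fun t =>
      freeCoeff φ₀ φ₁ k t - duhamel (freq k) (coeff (fun p => A p * φ p) k) t := by
  have hpot := (memLp_coeff (memLp_potential_mul A (Lp.memLp φ)) k).integrable one_le_two
  have hfree : ContinuousOn (freeCoeff φ₀ φ₁ k) (Icc 0 T) := by fun_prop
  have hduhamel : ContinuousOn (duhamel (freq k) (coeff (fun p => A p * φ p) k)) (Icc 0 T) :=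
    continuousOn_duhamel hpot
  refine ae_eq_of_integral_continuous_mul_eq ((memLp_coeff (Lp.memLp φ) k).integrable one_le_two)
    (memLp_one_iff_integrable.1 (memLp_restrict_Ioo_of_continuousOn (hfree.sub hduhamel)))
    fun q hq => ?_
  have hq_free : IntegrableOn (fun t => q t * freeCoeff φ₀ φ₁ k t) (Ioo 0 T) :=
    memLp_one_iff_integrable.1
      (memLp_restrict_Ioo_of_continuousOn (hq.continuousOn.mul hfree))
  have hq_duhamel : IntegrableOn
      (fun t => q t * duhamel (freq k) (coeff (fun p => A p * φ p) k) t) (Ioo 0 T) :=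
    memLp_one_iff_integrable.1
      (memLp_restrict_Ioo_of_continuousOn (hq.continuousOn.mul hduhamel))
  simp only [mul_sub]
  rw [integral_sub hq_free hq_duhamel, ← h.integral_mul_coeff hT hq k, add_sub_cancel_right]

end Transposition

section Weighted

variable {T l : ℝ} {v : ℝ → ℝ}

theorem integral_mul_exp_neg_le {r : ℝ} (hl : 0 < l) (hr : 0 ≤ r) :
    ∫ s in (0 : ℝ)..r, s * Real.exp (-(l * s)) ≤ 1 / l ^ 2 := by
  have hprimitive : ∀ s : ℝ, HasDerivAt
      (fun s => -((s / l + 1 / l ^ 2) * Real.exp (-(l * s)))) (s * Real.exp (-(l * s))) s := by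
    intro s
    have hexp : HasDerivAt (fun s : ℝ => Real.exp (-(l * s))) (Real.exp (-(l * s)) * -(l * 1)) s :=
      (((hasDerivAt_id s).const_mul l).neg).exp
    have haffine : HasDerivAt (fun s : ℝ => s / l + 1 / l ^ 2) (1 / l) s :=
      ((hasDerivAt_id s).div_const l).add_const _
    refine ((haffine.mul hexp).neg).congr_deriv ?_
    field_simp
    ring
  rw [intervalIntegral.integral_eq_sub_of_hasDerivAt (fun s _ => hprimitive s)
    (Continuous.intervalIntegrable (by fun_prop) _ _)]
  have hend : 0 ≤ (r / l + 1 / l ^ 2) * Real.exp (-(l * r)) := by positivity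
  simp only [zero_div, zero_add, mul_zero, neg_zero, Real.exp_zero, mul_one]
  linarith only [hend]

theorem abs_sin_mul_div_le (ω : ℝ) {r : ℝ} (hr : 0 ≤ r) : |Real.sin (ω * r) / ω| ≤ r := by
  rw [abs_div]
  refine div_le_of_le_mul₀ (abs_nonneg ω) hr (Real.abs_sin_le_abs.trans_eq ?_)
  rw [abs_mul, abs_of_nonneg hr, mul_comm]

theorem exp_mul_duhamel (l ω : ℝ) (v : ℝ → ℝ) (t : ℝ) :
    Real.exp (-(l * t)) * duhamel ω v t
      = ∫ s in (0 : ℝ)..t, Real.exp (-(l * (t - s))) * (Real.sin (ω * (t - s)) / ω)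
          * (Real.exp (-(l * s)) * v s) := by
  rw [duhamel, ← intervalIntegral.integral_const_mul]
  refine intervalIntegral.integral_congr fun s _ => ?_
  have hexp : Real.exp (-(l * t)) = Real.exp (-(l * (t - s))) * Real.exp (-(l * s)) := by
    rw [← Real.exp_add]
    ring_nf
  simp only [hexp]
  ring

theorem memLp_exp_mul (hv : MemLp v 2 (muTime T)) (l : ℝ) :
    MemLp (fun t => Real.exp (-(l * t)) * v t) 2 (muTime T) := by
  have hexp : MemLp (fun t => Real.exp (-(l * t))) ⊤ (muTime T) :=
    memLp_restrict_Ioo_of_continuousOn (by fun_prop)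
  exact hv.mul' hexp

theorem integral_exp_mul_duhamel_sq_le (hT : 0 ≤ T) (hl : 0 < l) (hv : MemLp v 2 (muTime T))
    (ω : ℝ) :
    ∫ t in Ioo 0 T, (Real.exp (-(l * t)) * duhamel ω v t) ^ 2
      ≤ (1 / l ^ 2) ^ 2 * ∫ t in Ioo 0 T, (Real.exp (-(l * t)) * v t) ^ 2 := by
  set κ : ℝ → ℝ := fun r => Real.exp (-(l * r)) * (Real.sin (ω * r) / ω)
  have hκ : Continuous κ := by fun_prop
  have hκ_le : ∫ r in (0 : ℝ)..T, |κ r| ≤ 1 / l ^ 2 := by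
    refine le_trans (intervalIntegral.integral_mono_on hT (hκ.abs.intervalIntegrable _ _)
      (Continuous.intervalIntegrable (by fun_prop) _ _) fun r hr => ?_)
      (integral_mul_exp_neg_le hl hT)
    rw [abs_mul, Real.abs_exp, mul_comm]
    gcongr
    exact abs_sin_mul_div_le ω hr.1
  simp only [exp_mul_duhamel]
  refine (integral_sq_convolution_le hT hκ (memLp_exp_mul hv l)).trans ?_
  gcongr
  exact intervalIntegral.integral_nonneg hT fun r _ => abs_nonneg _

theorem integral_duhamel_sq_le (hT : 0 ≤ T) (hv : MemLp v 2 (muTime T)) (ω : ℝ) :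
    ∫ t in Ioo 0 T, duhamel ω v t ^ 2 ≤ (T / ω) ^ 2 * ∫ t in Ioo 0 T, v t ^ 2 := by
  have hκ : Continuous fun r => Real.sin (ω * r) / ω := by fun_prop
  have hκ_le : ∫ r in (0 : ℝ)..T, |Real.sin (ω * r) / ω| ≤ |T / ω| := by
    have hconst := intervalIntegral.integral_mono_on (μ := volume) (g := fun _ => 1 / |ω|) hT
      (hκ.abs.intervalIntegrable 0 T) intervalIntegrable_const fun r _ => by
        rw [abs_div]
        exact div_le_div_of_nonneg_right (Real.abs_sin_le_one _) (abs_nonneg ω)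
    rwa [intervalIntegral.integral_const, sub_zero, smul_eq_mul, mul_one_div, ← abs_of_nonneg hT,
      ← abs_div, abs_of_nonneg hT] at hconst
  refine (integral_sq_convolution_le hT hκ hv).trans ?_
  rw [← sq_abs (T / ω)]
  gcongr
  exact intervalIntegral.integral_nonneg hT fun r _ => abs_nonneg _

end Weighted

section Energy

variable {T : ℝ} {f : ℝ × ℝ → ℝ}

theorem hasSum_integral_coeff_sq (hf : MemLp f 2 (volume.restrict (cyl T))) :
    HasSum (fun k => ∫ t in Ioo 0 T, coeff f k t ^ 2) (∫ p in cyl T, f p ^ 2) := by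
  have hsq := hf.integrable_sq
  have hsection : ∀ᵐ t ∂muTime T, HasSum (fun k => coeff f k t ^ 2)
      (∫ x in Ioo (0 : ℝ) 1, f (x, t) ^ 2) := by
    filter_upwards [memLp_two_section (restrict_cyl T ▸ hf)] with t ht using hasSum_coeff_sq ht
  rw [restrict_cyl] at hsq ⊢
  rw [integral_prod_symm _ hsq]
  refine hasSum_integral_of_dominated_convergence (fun k t => coeff f k t ^ 2)
    (fun k => (memLp_coeff hf k).aestronglyMeasurable.pow 2)
    (fun k => .of_forall fun t => by rw [Real.norm_eq_abs, abs_sq])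
    (hsection.mono fun t ht => ht.summable) ?_ hsection
  exact hsq.integral_prod_right.congr (hsection.mono fun t ht => ht.tsum_eq.symm)

theorem sum_integral_coeff_sq_le (hf : MemLp f 2 (volume.restrict (cyl T))) (s : Finset ℕ) :
    ∑ k ∈ s, ∫ t in Ioo 0 T, coeff f k t ^ 2 ≤ ∫ p in cyl T, f p ^ 2 :=
  sum_le_hasSum s (fun _ _ => integral_nonneg fun _ => sq_nonneg _) (hasSum_integral_coeff_sq hf)

theorem integral_potential_mul_sq_le (A : LinfCyl T) (hf : MemLp f 2 (volume.restrict (cyl T))) :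
    ∫ p in cyl T, (A p * f p) ^ 2 ≤ ‖A‖ ^ 2 * ∫ p in cyl T, f p ^ 2 := by
  rw [← integral_const_mul]
  refine integral_mono_ae (memLp_potential_mul A hf).integrable_sq
    (hf.integrable_sq.const_mul _) (A.ae_abs_le.mono fun p hp => ?_)
  simp only [mul_pow, ← sq_abs (A p)]
  gcongr

variable {A : LinfCyl T} {φ₀ : L2Omega} {φ₁ : HNegOne} {φ : L2Cyl T} {l : ℝ}

theorem IsTranspositionSolution.integral_exp_mul_coeff_sq_le (hT : 0 ≤ T) (hl : 0 < l)
    (h : IsTranspositionSolution T A 0 φ₀ φ₁ φ) (k : ℕ) :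
    ∫ t in Ioo 0 T, (Real.exp (-(l * t)) * coeff φ k t) ^ 2
      ≤ 2 * (T * dataSq φ₀ φ₁ k) + 2 * ((1 / l ^ 2) ^ 2 *
        ∫ t in Ioo 0 T, (Real.exp (-(l * t)) * coeff (fun p => A p * φ p) k t) ^ 2) := by
  have hpot := memLp_coeff (memLp_potential_mul A (Lp.memLp φ)) k
  set d := duhamel (freq k) (coeff (fun p => A p * φ p) k)
  have hd : IntegrableOn (fun t => (Real.exp (-(l * t)) * d t) ^ 2) (Ioo 0 T) := by
    refine memLp_one_iff_integrable.1 (memLp_restrict_Ioo_of_continuousOn (.pow (.mul ?_ ?_) 2))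
    · fun_prop
    · exact continuousOn_duhamel (hpot.integrable one_le_two)
  have hpointwise : ∀ᵐ t ∂muTime T, (Real.exp (-(l * t)) * coeff φ k t) ^ 2
      ≤ 2 * dataSq φ₀ φ₁ k + 2 * (Real.exp (-(l * t)) * d t) ^ 2 := by
    filter_upwards [h.coeff_ae_eq hT k, ae_restrict_mem measurableSet_Ioo] with t ht htT
    have hexp : Real.exp (-(l * t)) ^ 2 ≤ 1 :=
      pow_le_one₀ (Real.exp_pos _).le (Real.exp_le_one_iff.2 (by nlinarith only [hl, htT.1]))
    have hfree : (Real.exp (-(l * t)) * freeCoeff φ₀ φ₁ k t) ^ 2 ≤ dataSq φ₀ φ₁ k := by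
      rw [mul_pow]
      exact (mul_le_of_le_one_left (sq_nonneg _) hexp).trans (freeCoeff_sq_le φ₀ φ₁ k t)
    rw [ht, mul_sub]
    linarith only [hfree, sq_nonneg
      (Real.exp (-(l * t)) * freeCoeff φ₀ φ₁ k t + Real.exp (-(l * t)) * d t)]
  calc ∫ t in Ioo 0 T, (Real.exp (-(l * t)) * coeff φ k t) ^ 2
      ≤ ∫ t in Ioo 0 T, (2 * dataSq φ₀ φ₁ k + 2 * (Real.exp (-(l * t)) * d t) ^ 2) :=
        integral_mono_ae (memLp_exp_mul (memLp_coeff (Lp.memLp φ) k) l).integrable_sq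
          ((integrable_const _).add (hd.const_mul 2)) hpointwise
    _ = 2 * (T * dataSq φ₀ φ₁ k) + 2 * ∫ t in Ioo 0 T, (Real.exp (-(l * t)) * d t) ^ 2 := by
        rw [integral_add (integrable_const _) (hd.const_mul 2), setIntegral_const,
          Real.volume_real_Ioo_of_le hT, sub_zero, smul_eq_mul, mul_left_comm,
          integral_const_mul]
    _ ≤ _ := by
        gcongr
        exact integral_exp_mul_duhamel_sq_le hT hl hpot (freq k)

theorem IsTranspositionSolution.integral_exp_mul_sq_le (hT : 0 ≤ T) (hl : 0 < l)
    (hA : 2 * ‖A‖ ≤ l ^ 2) (h : IsTranspositionSolution T A 0 φ₀ φ₁ φ) :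
    ∫ p in cyl T, (Real.exp (-(l * p.2)) * φ p) ^ 2
      ≤ 4 * T * (‖φ₀‖ ^ 2 + ‖φ₁‖ ^ 2) := by
  have hψ : MemLp (fun p => Real.exp (-(l * p.2)) * φ p) 2 (volume.restrict (cyl T)) :=
    memLp_time_mul (Lp.memLp φ) (q := fun t => Real.exp (-(l * t))) (by fun_prop)
  set E := ∫ p in cyl T, (Real.exp (-(l * p.2)) * φ p) ^ 2
  have hpot : ∀ s : Finset ℕ, ∑ k ∈ s, ∫ t in Ioo 0 T,
      (Real.exp (-(l * t)) * coeff (fun p => A p * φ p) k t) ^ 2 ≤ ‖A‖ ^ 2 * E := by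
    intro s
    refine le_trans (le_of_eq ?_) ((sum_integral_coeff_sq_le (memLp_potential_mul A hψ) s).trans
      (integral_potential_mul_sq_le A hψ))
    simp only [← coeff_time_mul (fun t => Real.exp (-(l * t))), mul_left_comm]
  have hsum : ∀ s : Finset ℕ,
      ∑ k ∈ s, ∫ t in Ioo 0 T, (Real.exp (-(l * t)) * coeff φ k t) ^ 2
        ≤ 2 * (T * (‖φ₀‖ ^ 2 + ‖φ₁‖ ^ 2)) + 2 * ((1 / l ^ 2) ^ 2 * (‖A‖ ^ 2 * E)) := by
    intro s
    refine (Finset.sum_le_sum fun k _ => h.integral_exp_mul_coeff_sq_le hT hl k).trans ?_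
    simp only [Finset.sum_add_distrib, ← Finset.mul_sum]
    gcongr
    · exact sum_dataSq_le φ₀ φ₁ s
    · exact hpot s
  have hE : E ≤ 2 * (T * (‖φ₀‖ ^ 2 + ‖φ₁‖ ^ 2)) + 2 * ((1 / l ^ 2) ^ 2 * (‖A‖ ^ 2 * E)) := by
    refine hasSum_le_of_sum_le (hasSum_integral_coeff_sq hψ) fun s => ?_
    simpa only [coeff_time_mul (fun t => Real.exp (-(l * t)))] using hsum s
  have hE_nonneg : 0 ≤ E := integral_nonneg fun p => sq_nonneg _
  have hratio : ‖A‖ / l ^ 2 ≤ 1 / 2 := by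
    rw [div_le_iff₀ (by positivity)]
    linarith only [hA]
  have habsorb := mul_le_mul_of_nonneg_right (pow_le_pow_left₀ (by positivity) hratio 2) hE_nonneg
  have hregroup : (1 / l ^ 2) ^ 2 * (‖A‖ ^ 2 * E) = (‖A‖ / l ^ 2) ^ 2 * E := by ring
  linarith only [hE, habsorb, hregroup]

theorem IsTranspositionSolution.norm_sq_le (hT : 0 ≤ T)
    (h : IsTranspositionSolution T A 0 φ₀ φ₁ φ) :
    ‖φ‖ ^ 2 ≤ Real.exp (2 * √(2 * ‖A‖ + 1) * T) * (4 * T * (‖φ₀‖ ^ 2 + ‖φ₁‖ ^ 2)) := by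
  set l := √(2 * ‖A‖ + 1)
  have hl : 0 < l := Real.sqrt_pos.2 (by positivity)
  have hl_sq : l ^ 2 = 2 * ‖A‖ + 1 := Real.sq_sqrt (by positivity)
  refine le_trans ?_ (mul_le_mul_of_nonneg_left
    (h.integral_exp_mul_sq_le hT hl (by linarith only [hl_sq])) (Real.exp_pos _).le)
  rw [norm_sq_eq_integral_of_ae_eq .rfl, ← integral_const_mul]
  refine integral_mono_ae (Lp.memLp φ).integrable_sq ((memLp_time_mul (Lp.memLp φ)
    (q := fun t => Real.exp (-(l * t))) (by fun_prop)).integrable_sq.const_mul _) ?_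
  filter_upwards [ae_restrict_mem (measurableSet_Ioo.prod measurableSet_Ioo)] with p hp
  have hweight : 1 ≤ Real.exp (2 * l * T) * Real.exp (-(l * p.2)) ^ 2 := by
    rw [← Real.exp_nat_mul, ← Real.exp_add]
    refine Real.one_le_exp ?_
    have htime := mul_le_mul_of_nonneg_left hp.2.2.le hl.le
    push_cast
    linarith only [htime]
  rw [mul_pow, ← mul_assoc]
  exact le_mul_of_one_le_left (sq_nonneg _) hweight

end Energy

/-! ### The trace at `x = 1` -/

theorem integral_freeCoeff_mul_freeCoeff (φ₀ : L2Omega) (φ₁ : HNegOne) (j k m : ℕ) :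
    ∫ t in (0 : ℝ)..(2 * m : ℕ), freeCoeff φ₀ φ₁ j t * freeCoeff φ₀ φ₁ k t
      = if j = k then m * dataSq φ₀ φ₁ k else 0 := by
  set a := fun k => inner ℝ (modeL2 k) φ₀ with ha
  set b := fun k => φ₁ (modeH1 k) / freq k with hb
  have hexpand : ∀ t, freeCoeff φ₀ φ₁ j t * freeCoeff φ₀ φ₁ k t
      = a j * a k * (Real.cos (freq j * t) * Real.cos (freq k * t))
        + a j * b k * (Real.cos (freq j * t) * Real.sin (freq k * t))
        + b j * a k * (Real.cos (freq k * t) * Real.sin (freq j * t))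
        + b j * b k * (Real.sin (freq j * t) * Real.sin (freq k * t)) := by
    intro t
    simp only [freeCoeff, ha, hb]
    ring
  simp only [hexpand]
  rw [intervalIntegral.integral_add (Continuous.intervalIntegrable (by fun_prop) _ _)
      (Continuous.intervalIntegrable (by fun_prop) _ _),
    intervalIntegral.integral_add (Continuous.intervalIntegrable (by fun_prop) _ _)
      (Continuous.intervalIntegrable (by fun_prop) _ _),
    intervalIntegral.integral_add (Continuous.intervalIntegrable (by fun_prop) _ _)
      (Continuous.intervalIntegrable (by fun_prop) _ _)]
  simp only [intervalIntegral.integral_const_mul, integral_cos_freq_mul_cos_freq,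
    integral_sin_freq_mul_sin_freq, integral_cos_freq_mul_sin_freq]
  split_ifs with hjk
  · subst hjk
    simp only [dataSq, ha, hb]
    push_cast
    ring
  · ring

theorem integral_sum_freeCoeff_sq_le {T : ℝ} (hT : 0 ≤ T) {m : ℕ} (hm : T ≤ (2 * m : ℕ))
    (φ₀ : L2Omega) (φ₁ : HNegOne) {c : ℕ → ℝ} (hc : ∀ k, c k ^ 2 ≤ 2) (s : Finset ℕ) :
    ∫ t in Ioo 0 T, (∑ k ∈ s, c k * freeCoeff φ₀ φ₁ k t) ^ 2
      ≤ 2 * m * ∑ k ∈ s, dataSq φ₀ φ₁ k := by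
  have hexpand : ∀ t, (∑ k ∈ s, c k * freeCoeff φ₀ φ₁ k t) ^ 2 = ∑ j ∈ s, ∑ k ∈ s,
      c j * c k * (freeCoeff φ₀ φ₁ j t * freeCoeff φ₀ φ₁ k t) := by
    intro t
    rw [sq, Finset.sum_mul_sum]
    exact Finset.sum_congr rfl fun j _ => Finset.sum_congr rfl fun k _ => by ring
  calc ∫ t in Ioo 0 T, (∑ k ∈ s, c k * freeCoeff φ₀ φ₁ k t) ^ 2
      ≤ ∫ t in (0 : ℝ)..(2 * m : ℕ), (∑ k ∈ s, c k * freeCoeff φ₀ φ₁ k t) ^ 2 := by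
        rw [← intervalIntegral_eq_integral_Ioo hT]
        exact intervalIntegral.integral_mono_interval le_rfl hT hm
          (.of_forall fun t => sq_nonneg _) (Continuous.intervalIntegrable (by fun_prop) _ _)
    _ = ∑ j ∈ s, c j ^ 2 * (m * dataSq φ₀ φ₁ j) := by
        simp only [hexpand]
        rw [intervalIntegral.integral_finsetSum fun j _ =>
          Continuous.intervalIntegrable (by fun_prop) _ _]
        refine Finset.sum_congr rfl fun j hj => ?_
        rw [intervalIntegral.integral_finsetSum fun k _ =>
          Continuous.intervalIntegrable (by fun_prop) _ _]
        simp only [intervalIntegral.integral_const_mul, integral_freeCoeff_mul_freeCoeff, mul_ite,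
          mul_zero]
        rw [Finset.sum_ite_eq, if_pos hj, sq]
    _ ≤ ∑ j ∈ s, 2 * (m * dataSq φ₀ φ₁ j) := by
        refine Finset.sum_le_sum fun j _ => mul_le_mul_of_nonneg_right (hc j) ?_
        exact mul_nonneg m.cast_nonneg (dataSq_nonneg φ₀ φ₁ j)
    _ = 2 * m * ∑ k ∈ s, dataSq φ₀ φ₁ k := by
        rw [Finset.mul_sum]
        exact Finset.sum_congr rfl fun j _ => by ring

theorem integral_sum_duhamel_sq_le {T : ℝ} (hT : 0 ≤ T) {v : ℕ → ℝ → ℝ}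
    (hv : ∀ k, MemLp (v k) 2 (muTime T)) {c : ℕ → ℝ} (hc : ∀ k, c k ^ 2 ≤ 2) (s : Finset ℕ) :
    ∫ t in Ioo 0 T, (∑ k ∈ s, c k * duhamel (freq k) (v k) t) ^ 2
      ≤ 2 * T ^ 2 * (∑' k : ℕ, 1 / ((k : ℝ) + 1) ^ 2)
        * ∑ k ∈ s, ∫ t in Ioo 0 T, v k t ^ 2 := by
  set Z := ∑' k : ℕ, 1 / ((k : ℝ) + 1) ^ 2
  have hd : ∀ k, IntegrableOn (fun t => duhamel (freq k) (v k) t ^ 2) (Ioo 0 T) := fun k =>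
    memLp_one_iff_integrable.1 (memLp_restrict_Ioo_of_continuousOn
      ((continuousOn_duhamel ((hv k).integrable one_le_two)).pow 2))
  have hweights : ∑ k ∈ s, (c k * (freq k)⁻¹) ^ 2 ≤ 2 * Z := by
    refine le_trans ?_ (mul_le_mul_of_nonneg_left (sum_inv_freq_sq_le s) two_pos.le)
    rw [Finset.mul_sum]
    refine Finset.sum_le_sum fun k _ => ?_
    rw [mul_pow]
    exact mul_le_mul_of_nonneg_right (hc k) (sq_nonneg _)
  have hZ : 0 ≤ 2 * Z := (Finset.sum_nonneg fun k _ => sq_nonneg _).trans hweights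
  have hpointwise : ∀ t, (∑ k ∈ s, c k * duhamel (freq k) (v k) t) ^ 2
      ≤ 2 * Z * ∑ k ∈ s, freq k ^ 2 * duhamel (freq k) (v k) t ^ 2 := by
    intro t
    have hcs := Finset.sum_mul_sq_le_sq_mul_sq s (fun k => c k * (freq k)⁻¹)
      fun k => freq k * duhamel (freq k) (v k) t
    simp only [mul_assoc, inv_mul_cancel_left₀ (freq_ne_zero _), mul_pow (freq _)] at hcs
    refine hcs.trans (mul_le_mul_of_nonneg_right hweights ?_)
    exact Finset.sum_nonneg fun k _ => by positivity
  calc ∫ t in Ioo 0 T, (∑ k ∈ s, c k * duhamel (freq k) (v k) t) ^ 2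
      ≤ ∫ t in Ioo 0 T, 2 * Z * ∑ k ∈ s, freq k ^ 2 * duhamel (freq k) (v k) t ^ 2 :=
        integral_mono_of_nonneg (.of_forall fun t => sq_nonneg _)
          ((integrable_finsetSum s fun k _ => (hd k).const_mul _).const_mul _)
          (.of_forall hpointwise)
    _ = 2 * Z * ∑ k ∈ s, freq k ^ 2 * ∫ t in Ioo 0 T, duhamel (freq k) (v k) t ^ 2 := by
        rw [integral_const_mul, integral_finsetSum s fun k _ => (hd k).const_mul _]
        simp only [integral_const_mul]
    _ ≤ 2 * Z * ∑ k ∈ s, T ^ 2 * ∫ t in Ioo 0 T, v k t ^ 2 := by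
        refine mul_le_mul_of_nonneg_left (Finset.sum_le_sum fun k _ => ?_) hZ
        refine (mul_le_mul_of_nonneg_left (integral_duhamel_sq_le hT (hv k) (freq k))
          (sq_nonneg _)).trans_eq ?_
        rw [← mul_assoc, ← mul_pow, mul_div_cancel₀ _ (freq_ne_zero k)]
    _ = _ := by
        rw [← Finset.mul_sum]
        ring

/-- The constant `K` in the bound `‖φ(1, ·)‖² ≤ K (‖φ₀‖² + ‖φ₁‖² + ‖A φ‖²)`. The first summand comes
from the free waves, which are orthogonal over `(0, 2⌈T⌉)`, the second from the Duhamel terms. -/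
def traceConst (T : ℝ) : ℝ := 4 * ⌈T⌉₊ + 4 * T ^ 2 * ∑' k : ℕ, 1 / ((k : ℝ) + 1) ^ 2

theorem traceConst_nonneg (T : ℝ) : 0 ≤ traceConst T := by
  unfold traceConst
  positivity

section Expansion

variable {T : ℝ} {f : ℝ × ℝ → ℝ}

/-- The `N`-th partial sum of the expansion of `f(·, t)` along the eigenfunctions, as a function of
`p = (x, t)`. -/
def partialSum (f : ℝ × ℝ → ℝ) (N : ℕ) (p : ℝ × ℝ) : ℝ :=
  ∑ k ∈ Finset.range N, mode k p.1 * coeff f k p.2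

theorem memLp_partialSum (hf : MemLp f 2 (volume.restrict (cyl T))) (N : ℕ) :
    MemLp (partialSum f N) 2 (volume.restrict (cyl T)) := by
  refine memLp_finsetSum _ fun k _ => ?_
  have hcoeff : MemLp (fun p : ℝ × ℝ => coeff f k p.2) 2 (volume.restrict (cyl T)) := by
    rw [restrict_cyl]
    exact (memLp_coeff hf k).comp_snd muOmega
  have hmode : MemLp (fun p : ℝ × ℝ => mode k p.1) ⊤ (volume.restrict (cyl T)) :=
    memLp_top_of_bound (by fun_prop) (√2) (.of_forall fun p => abs_mode_le k p.1)
  exact hcoeff.mul' hmode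

theorem integral_sub_partialSum_sq {t : ℝ} (hf : MemLp (fun x => f (x, t)) 2 muOmega) (N : ℕ) :
    ∫ x in Ioo (0 : ℝ) 1, (f (x, t) - partialSum f N (x, t)) ^ 2
      = (∫ x in Ioo (0 : ℝ) 1, f (x, t) ^ 2) - ∑ k ∈ Finset.range N, coeff f k t ^ 2 := by
  have hparseval := norm_sub_sum_inner_smul_sq orthonormal_modeL2 hf.toLp (Finset.range N)
  simp only [← coeff_eq_inner hf] at hparseval
  rw [norm_sq_eq_integral_of_ae_eq hf.coeFn_toLp] at hparseval
  rw [← hparseval]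
  simp only [partialSum, mul_comm (mode _ _)]
  exact (norm_sq_toLp_sub_of_ae_eq hf (sum_smul_toLp_ae_eq memLp_mode _ _)).symm

theorem tendsto_integral_sub_partialSum_sq (hf : MemLp f 2 (volume.restrict (cyl T))) :
    Tendsto (fun N => ∫ p in cyl T, (f p - partialSum f N p) ^ 2) atTop (𝓝 0) := by
  have hcoeff_sq := fun k => (memLp_coeff hf k).integrable_sq
  have hparseval : ∀ N, ∫ p in cyl T, (f p - partialSum f N p) ^ 2
      = (∫ p in cyl T, f p ^ 2) - ∑ k ∈ Finset.range N, ∫ t in Ioo 0 T, coeff f k t ^ 2 := by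
    intro N
    have hremainder :
        Integrable (fun p => (f p - partialSum f N p) ^ 2) (volume.restrict (cyl T)) :=
      (hf.sub (memLp_partialSum hf N)).integrable_sq
    have hsq := hf.integrable_sq
    rw [restrict_cyl] at hremainder hsq ⊢
    rw [integral_prod_symm _ hremainder, integral_prod_symm _ hsq,
      ← integral_finsetSum _ fun k _ => hcoeff_sq k,
      ← integral_sub hsq.integral_prod_right (integrable_finsetSum _ fun k _ => hcoeff_sq k)]
    refine integral_congr_ae ?_
    filter_upwards [memLp_two_section (restrict_cyl T ▸ hf)] with t ht
    exact integral_sub_partialSum_sq ht N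
  simp only [hparseval]
  have hlim := (hasSum_integral_coeff_sq hf).tendsto_sum_nat.const_sub (∫ p in cyl T, f p ^ 2)
  rwa [sub_self] at hlim

theorem ae_eq_of_tendsto_partialSum (hf : MemLp f 2 (volume.restrict (cyl T)))
    {Φ : ℝ → L2Time T} (hΦ : ∀ x ∈ Icc (0 : ℝ) 1, Tendsto
      (fun N => ∑ k ∈ Finset.range N, mode k x • (memLp_coeff hf k).toLp) atTop (𝓝 (Φ x))) :
    ∀ᵐ x ∂muOmega, Φ x =ᵐ[muTime T] fun t => f (x, t) := by
  have hsection : ∀ᵐ x ∂muOmega, MemLp (fun t => f (x, t)) 2 (muTime T) :=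
    memLp_two_section (f := fun p => f p.swap)
      ((restrict_cyl T ▸ hf).comp_measurePreserving Measure.measurePreserving_swap)
  have hremainder : ∀ N,
      Integrable (fun p => (f p - partialSum f N p) ^ 2) (muOmega.prod (muTime T)) := fun N =>
    restrict_cyl T ▸ (hf.sub (memLp_partialSum hf N)).integrable_sq
  have hdefect : (fun x => ∫ t in Ioo 0 T, (f (x, t) - Φ x t) ^ 2) =ᵐ[muOmega] 0 := by
    refine ae_eq_zero_of_tendsto_integral
      (g := fun N x => ∫ t in Ioo 0 T, (f (x, t) - partialSum f N (x, t)) ^ 2)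
      (fun N => (hremainder N).integral_prod_left)
      (fun N x => integral_nonneg fun t => sq_nonneg _) ?_ ?_
    · refine (tendsto_integral_sub_partialSum_sq hf).congr fun N => ?_
      rw [restrict_cyl, integral_prod _ (hremainder N)]
    · filter_upwards [hsection, ae_restrict_mem measurableSet_Ioo] with x hfx hx
      rw [← norm_sq_toLp_sub_of_ae_eq hfx .rfl]
      have hlim := ((hΦ x (Ioo_subset_Icc_self hx)).const_sub hfx.toLp).norm.pow 2
      refine hlim.congr fun N => ?_
      exact norm_sq_toLp_sub_of_ae_eq hfx (sum_smul_toLp_ae_eq (memLp_coeff hf) _ _)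
  filter_upwards [hdefect, hsection] with x hx hfx
  rw [← norm_sq_toLp_sub_of_ae_eq hfx .rfl, Pi.zero_apply, sq_eq_zero_iff,
    norm_sub_eq_zero_iff] at hx
  exact hx ▸ hfx.coeFn_toLp

end Expansion

section Trace

variable {T : ℝ} {A : LinfCyl T} {φ₀ : L2Omega} {φ₁ : HNegOne} {φ : L2Cyl T}

theorem IsTranspositionSolution.norm_sq_sum_mode_smul_le (hT : 0 ≤ T)
    (h : IsTranspositionSolution T A 0 φ₀ φ₁ φ) (s : Finset ℕ) (x : ℝ) :
    ‖∑ k ∈ s, mode k x • (memLp_coeff (Lp.memLp φ) k).toLp‖ ^ 2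
      ≤ traceConst T * ∑ k ∈ s, (dataSq φ₀ φ₁ k
        + ∫ t in Ioo 0 T, coeff (fun p => A p * φ p) k t ^ 2) := by
  have hpot := memLp_coeff (memLp_potential_mul A (Lp.memLp φ))
  set F : ℝ → ℝ := fun t => ∑ k ∈ s, mode k x * freeCoeff φ₀ φ₁ k t
  set G : ℝ → ℝ := fun t =>
    ∑ k ∈ s, mode k x * duhamel (freq k) (coeff (fun p => A p * φ p) k) t
  have hF : MemLp F 2 (muTime T) := memLp_restrict_Ioo_of_continuousOn (by fun_prop)
  have hG : MemLp G 2 (muTime T) := memLp_restrict_Ioo_of_continuousOn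
    (continuousOn_finsetSum s fun k _ => continuousOn_const.mul
      (continuousOn_duhamel ((hpot k).integrable one_le_two)))
  set D := ∑ k ∈ s, dataSq φ₀ φ₁ k
  set E := ∑ k ∈ s, ∫ t in Ioo 0 T, coeff (fun p => A p * φ p) k t ^ 2
  set Z := ∑' k : ℕ, 1 / ((k : ℝ) + 1) ^ 2
  have hcross : 0 ≤ ⌈T⌉₊ * E + T ^ 2 * Z * D :=
    add_nonneg (mul_nonneg ⌈T⌉₊.cast_nonneg
        (Finset.sum_nonneg fun k _ => integral_nonneg fun t => sq_nonneg _))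
      (mul_nonneg (by positivity) (Finset.sum_nonneg fun k _ => dataSq_nonneg φ₀ φ₁ k))
  have hF_le : ∫ t in Ioo 0 T, F t ^ 2 ≤ 2 * ⌈T⌉₊ * D := by
    refine integral_sum_freeCoeff_sq_le hT ?_ φ₀ φ₁ (fun k => sq_mode_le k x) s
    exact (Nat.le_ceil T).trans (Nat.cast_le.2 (Nat.le_mul_of_pos_left _ two_pos))
  have hG_le : ∫ t in Ioo 0 T, G t ^ 2 ≤ 2 * T ^ 2 * Z * E :=
    integral_sum_duhamel_sq_le hT hpot (fun k => sq_mode_le k x) s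
  calc ‖∑ k ∈ s, mode k x • (memLp_coeff (Lp.memLp φ) k).toLp‖ ^ 2
      = ∫ t in Ioo 0 T, (F t - G t) ^ 2 := by
        refine norm_sq_eq_integral_of_ae_eq ((sum_smul_toLp_ae_eq _ _ s).trans ?_)
        filter_upwards [ae_all_iff.2 (h.coeff_ae_eq hT)] with t ht
        simp only [ht, mul_sub, Finset.sum_sub_distrib, F, G]
    _ ≤ 2 * (∫ t in Ioo 0 T, F t ^ 2) + 2 * ∫ t in Ioo 0 T, G t ^ 2 := integral_sub_sq_le hF hG
    _ ≤ 2 * (2 * ⌈T⌉₊ * D) + 2 * (2 * T ^ 2 * Z * E) := by gcongr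
    _ ≤ traceConst T * (D + E) := by
        unfold traceConst
        linarith only [hcross]
    _ = _ := by rw [Finset.sum_add_distrib]

theorem IsTranspositionSolution.exists_trace (hT : 0 ≤ T)
    (h : IsTranspositionSolution T A 0 φ₀ φ₁ φ) :
    ∃ θ : L2Time T, IsTraceAtOne T φ θ ∧
      ‖θ‖ ^ 2 ≤ traceConst T * (‖φ₀‖ ^ 2 + ‖φ₁‖ ^ 2 + ‖A‖ ^ 2 * ‖φ‖ ^ 2) := by
  set d : ℕ → ℝ := fun k => dataSq φ₀ φ₁ k
    + ∫ t in Ioo 0 T, coeff (fun p => A p * φ p) k t ^ 2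
  have hd_nonneg : ∀ k, 0 ≤ d k := fun k =>
    add_nonneg (dataSq_nonneg φ₀ φ₁ k) (integral_nonneg fun t => sq_nonneg _)
  have hd_sum : ∀ s : Finset ℕ, ∑ k ∈ s, d k ≤ ‖φ₀‖ ^ 2 + ‖φ₁‖ ^ 2 + ‖A‖ ^ 2 * ‖φ‖ ^ 2 := by
    intro s
    rw [Finset.sum_add_distrib, norm_sq_eq_integral_of_ae_eq (u := φ) .rfl]
    exact add_le_add (sum_dataSq_le φ₀ φ₁ s)
      ((sum_integral_coeff_sq_le (memLp_potential_mul A (Lp.memLp φ)) s).trans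
        (integral_potential_mul_sq_le A (Lp.memLp φ)))
  have hd := summable_of_sum_le hd_nonneg hd_sum
  obtain ⟨Φ, hΦ_cont, hΦ_lim, hΦ_le⟩ := exists_continuousOn_tendsto_sum_of_norm_sq_le
    (K := Icc (0 : ℝ) 1) (f := fun k x => mode k x • (memLp_coeff (Lp.memLp φ) k).toLp)
    (fun k => ((continuous_mode k).smul continuous_const).continuousOn)
    (hd.mul_left (traceConst T)) fun s x _ => by
      rw [← Finset.mul_sum]
      exact h.norm_sq_sum_mode_smul_le hT s x
  refine ⟨Φ 1, ⟨Φ, hΦ_cont, ae_eq_of_tendsto_partialSum (Lp.memLp φ) hΦ_lim, rfl⟩,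
    (hΦ_le 1 (right_mem_Icc.2 zero_le_one)).trans ?_⟩
  rw [tsum_mul_left]
  exact mul_le_mul_of_nonneg_left (hd.tsum_le_of_sum_le hd_sum) (traceConst_nonneg T)

theorem one_add_sq_mul_exp_le {a : ℝ} (hT : 0 ≤ T) (ha : 0 ≤ a) :
    1 + a ^ 2 * (Real.exp (2 * √(2 * a + 1) * T) * (4 * T))
      ≤ (1 + 16 * T * Real.exp (2 * T)) * Real.exp ((1 + 2 * T) * √a) ^ 2 := by
  obtain ⟨y, hy, rfl⟩ : ∃ y, 0 ≤ y ∧ a = y ^ 2 := ⟨√a, Real.sqrt_nonneg a, (Real.sq_sqrt ha).symm⟩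
  rw [Real.sqrt_sq hy]
  have hpoly : (y ^ 2) ^ 2 ≤ (2 * Real.exp y) ^ 2 := by
    gcongr
    linarith only [Real.quadratic_le_exp_of_nonneg hy, hy]
  have hsqrt : √(2 * y ^ 2 + 1) ≤ 1 + 2 * y :=
    Real.sqrt_le_iff.2 ⟨by positivity, by linarith only [hy, sq_nonneg y]⟩
  have hexp : Real.exp (2 * √(2 * y ^ 2 + 1) * T) ≤ Real.exp (2 * (1 + 2 * y) * T) := by
    gcongr
  have hsplit : Real.exp y ^ 2 * Real.exp (2 * (1 + 2 * y) * T)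
      = Real.exp (2 * T) * Real.exp ((1 + 2 * T) * y) ^ 2 := by
    simp only [← Real.exp_nat_mul, ← Real.exp_add]
    ring_nf
  have hone : 1 ≤ Real.exp ((1 + 2 * T) * y) ^ 2 := one_le_pow₀ (Real.one_le_exp (by positivity))
  calc 1 + (y ^ 2) ^ 2 * (Real.exp (2 * √(2 * y ^ 2 + 1) * T) * (4 * T))
      ≤ Real.exp ((1 + 2 * T) * y) ^ 2
        + (2 * Real.exp y) ^ 2 * (Real.exp (2 * (1 + 2 * y) * T) * (4 * T)) := by gcongr
    _ = Real.exp ((1 + 2 * T) * y) ^ 2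
        + 16 * T * (Real.exp y ^ 2 * Real.exp (2 * (1 + 2 * y) * T)) := by ring
    _ = _ := by
        rw [hsplit]
        ring

theorem IsTranspositionSolution.exists_trace_norm_le (hT : 0 ≤ T)
    (h : IsTranspositionSolution T A 0 φ₀ φ₁ φ) :
    ∃ θ : L2Time T, IsTraceAtOne T φ θ ∧
      ‖θ‖ ≤ √(traceConst T * (1 + 16 * T * Real.exp (2 * T)))
        * Real.exp ((1 + 2 * T) * √‖A‖) * √(‖φ₀‖ ^ 2 + ‖φ₁‖ ^ 2) := by
  obtain ⟨θ, hθ, hle⟩ := h.exists_trace hT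
  refine ⟨θ, hθ, ?_⟩
  have hK := traceConst_nonneg T
  set K := traceConst T
  set D := ‖φ₀‖ ^ 2 + ‖φ₁‖ ^ 2
  have hD : 0 ≤ D := by positivity
  refine (sq_le_sq₀ (norm_nonneg _) (by positivity)).1 (hle.trans ?_)
  calc K * (D + ‖A‖ ^ 2 * ‖φ‖ ^ 2)
      ≤ K * (D + ‖A‖ ^ 2 * (Real.exp (2 * √(2 * ‖A‖ + 1) * T) * (4 * T * D))) := by
        gcongr
        exact h.norm_sq_le hT
    _ = K * (1 + ‖A‖ ^ 2 * (Real.exp (2 * √(2 * ‖A‖ + 1) * T) * (4 * T))) * D := by ring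
    _ ≤ K * ((1 + 16 * T * Real.exp (2 * T)) * Real.exp ((1 + 2 * T) * √‖A‖) ^ 2) * D := by
        gcongr
        exact one_add_sq_mul_exp_le hT (norm_nonneg A)
    _ = _ := by
        rw [mul_pow, mul_pow, Real.sq_sqrt (by positivity), Real.sq_sqrt hD, ← mul_assoc K]

end Trace

end HiddenReg

end

theorem proposition1 (T : ℝ) (hT : 0 < T) :
    ∃ C : ℝ, 0 < C ∧
      ∀ (A : HiddenReg.LinfCyl T) (φ₀ : HiddenReg.L2Omega) (φ₁ : HiddenReg.HNegOne)
        (φ : HiddenReg.L2Cyl T),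
        HiddenReg.IsTranspositionSolution T A 0 φ₀ φ₁ φ →
          ∃ θ : HiddenReg.L2Time T, HiddenReg.IsTraceAtOne T φ θ ∧
            ‖θ‖ ≤ C * Real.exp (C * Real.sqrt ‖A‖) * Real.sqrt (‖φ₀‖ ^ 2 + ‖φ₁‖ ^ 2) := by
  set B := √(HiddenReg.traceConst T * (1 + 16 * T * Real.exp (2 * T)))
  have hB : 0 ≤ B := Real.sqrt_nonneg _
  refine ⟨B + (1 + 2 * T), by positivity, fun A φ₀ φ₁ φ h => ?_⟩
  obtain ⟨θ, hθ, hle⟩ := h.exists_trace_norm_le hT.le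
  refine ⟨θ, hθ, hle.trans ?_⟩
  have hB_le : B ≤ B + (1 + 2 * T) := by linarith only [hT]
  have hT_le : 1 + 2 * T ≤ B + (1 + 2 * T) := by linarith only [hB]
  gcongr
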